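/- Let $M$ be a (Hausdorff, finite-dimensional, boundaryless) smooth manifold and $p\in M$. For $k\ge 0$ and $r\in\{0,1,\dots,\infty\}$ let $\mathcal E^k_r(M)$ be the space of $C^r$ differential $k$-forms on $M$ with its usual topology (uniform convergence, on compact subsets of charts, of the coefficients and of their derivatives of all finite orders $\le r$), and put $\mathcal E^k(M)=\mathcal E^k_\infty(M)$. Let $\mathcal U_k(M;p)$ be the space of de Rham currents of dimension $k$ supported at $p$, that is, of the continuous linear functionals $T$ on $\mathcal E^k(M)$ with $T(\omega)=0$ whenever $\omega$ vanishes in a neighbourhood of $p$. Let $\mathcal U_k^r(M;p)\subseteq\mathcal U_k(M;p)$, $r\in\mathbb N$, be the subspace of currents of order at most $r$, that is, of those which extend to a continuous linear functional on $\mathcal E^k_r(M)$. The fiber of $\mathcal U(M)$ at $p$ is $\mathcal U(M;p)=\bigoplus_{k\ge 0}\mathcal U_k(M;p)$. A form $\omega\in\mathcal E^k(M)$ is evaluated on $T\in\mathcal U(M;p)$ by $\omega(T)=T_k(\omega)$, with $T_k$ the component of $T$ of dimension $k$, and $(\omega\otimes\eta)(S\otimes T)=\omega(S)\,\eta(T)$.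 Then $\mathcal U(M;p)$ is a filtered differential graded co-algebra: there are linear maps $\Delta:\mathcal U(M;p)\to\mathcal U(M;p)\otimes\mathcal U(M;p)$, $\epsilon:\mathcal U(M;p)\to\mathbb R$ and $\partial:\mathcal U_{k+1}(M;p)\to\mathcal U_k(M;p)$ for $k\ge 0$ (with $\partial=0$ on $\mathcal U_0(M;p)$) such that 1. $\Delta$ is co-associative with co-unit $\epsilon$, and $\epsilon$ vanishes on $\mathcal U_k(M;p)$ for $k\geq 1$; 2. $\mathcal U_k^0(M;p)\subseteq\mathcal U_k^1(M;p)\subseteq\cdots$ with $\bigcup_r\mathcal U_k^r(M;p)=\mathcal U_k(M;p)$ for every $k$; moreover $\Delta(\mathcal U_l^r(M;p))\subseteq\sum_{a+b=l}\sum_{s+t=r}\mathcal U_a^s(M;p)\otimes\mathcal U_b^t(M;p)$ and $\partial(\mathcal U_{k+1}^r(M;p))\subseteq\mathcal U_k^{r+1}(M;p)$; 3. $\partial\circ\partial=0$, $\epsilon\circ\partial=0$, and $\partial$ is a co-derivation: $\Delta\circ\partial=(\partial\otimes\mathrm{id}+\sigma\otimes\partial)\circ\Delta$, where $\sigma=(-1)^k$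 on $\mathcal U_k(M;p)$; 4. the co-product is dual to the wedge product, $(\omega\otimes\eta)(\Delta T)=(\omega\wedge\eta)(T)$ for all $\omega\in\mathcal E^a(M)$, $\eta\in\mathcal E^b(M)$, $T\in\mathcal U(M;p)$; the co-unit is $\epsilon(T)=1(T)$, where $1\in\mathcal E^0(M)$ is the constant function; and the differential is dual to the exterior derivative, $(\partial T)(\omega)=T(d\omega)$ for all $T\in\mathcal U_{k+1}(M;p)$ and $\omega\in\mathcal E^k(M)$. -/

import Mathlib

open scoped Manifold ContDiff Topology TensorProduct DirectSum

noncomputable section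

/-! ### Filtered differential graded coalgebras -/

section Coalgebra

universe u

variable {U : ℕ → Type u} [∀ k, AddCommGroup (U k)] [∀ k, Module ℝ (U k)]

/-- The degree `-1` endomorphism of `⨁ k, U k` assembled from maps `U (k + 1) → U k`
(it vanishes on `U 0`). -/
def totalBoundary (bd : ∀ k, U (k + 1) →ₗ[ℝ] U k) : (⨁ k, U k) →ₗ[ℝ] ⨁ k, U k :=
  DirectSum.toModule ℝ ℕ _ fun k =>
    match k with
    | 0 => 0
    | k + 1 => DirectSum.lof ℝ ℕ U k ∘ₗ bd k

variable (U) in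
/-- The sign operator, multiplication by `(-1) ^ k` on `U k`. -/
def gradingSign : (⨁ k, U k) →ₗ[ℝ] ⨁ k, U k :=
  DirectSum.toModule ℝ ℕ _ fun k => (-1 : ℝ) ^ k • DirectSum.lof ℝ ℕ U k

/-- The part of total degree `l` and total filtration `≤ r` of `(⨁ k, U k) ⊗ (⨁ k, U k)`, that is
`∑_{a + b = l} ∑_{s + t = r} F a s ⊗ F b t`. -/
def tensorFiltration (F : ∀ k, ℕ → Submodule ℝ (U k)) (l r : ℕ) :
    Submodule ℝ ((⨁ k, U k) ⊗[ℝ] (⨁ k, U k)) :=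
  ⨆ ab ∈ Finset.HasAntidiagonal.antidiagonal l, ⨆ st ∈ Finset.HasAntidiagonal.antidiagonal r,
    LinearMap.range (TensorProduct.map
      (DirectSum.lof ℝ ℕ U ab.1 ∘ₗ (F ab.1 st.1).subtype)
      (DirectSum.lof ℝ ℕ U ab.2 ∘ₗ (F ab.2 st.2).subtype))

/-- A filtered differential graded coalgebra structure on the graded real vector space
`⨁ k, U k`, whose degree `k` part is filtered by the subspaces `F k 0, F k 1, …`.
The coalgebra is coassociative and counital (by `Coalgebra`), all structure maps respect the
grading, the differential has degree `-1`, is a coderivation (with the Koszul sign) and may raise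
the filtration by one, as the transpose of a first order differential operator does. -/
structure FilteredDGCoalgebra (U : ℕ → Type u) [∀ k, AddCommGroup (U k)] [∀ k, Module ℝ (U k)]
    (F : ∀ k, ℕ → Submodule ℝ (U k)) extends Coalgebra ℝ (⨁ k, U k) where
  /-- the differential -/
  boundary : ∀ k, U (k + 1) →ₗ[ℝ] U k
  filtration_mono : ∀ k, Monotone (F k)
  filtration_exhaustive : ∀ k, ∀ x : U k, ∃ r, x ∈ F k r
  comul_mem : ∀ l r, ∀ x ∈ F l r, comul (DirectSum.lof ℝ ℕ U l x) ∈ tensorFiltration F l r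
  counit_lof_succ : ∀ k, ∀ x : U (k + 1), counit (DirectSum.lof ℝ ℕ U (k + 1) x) = 0
  boundary_mem : ∀ k r, ∀ x ∈ F (k + 1) r, boundary k x ∈ F k (r + 1)
  boundary_boundary : ∀ k, ∀ x : U (k + 2), boundary k (boundary (k + 1) x) = 0
  counit_boundary : ∀ x : U 1, counit (DirectSum.lof ℝ ℕ U 0 (boundary 0 x)) = 0
  comul_boundary : comul ∘ₗ totalBoundary boundary =
    (TensorProduct.map (totalBoundary boundary) LinearMap.id +
      TensorProduct.map (gradingSign U) (totalBoundary boundary)) ∘ₗ comul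

end Coalgebra

/-! ### Wedge product of alternating forms -/

section Wedge

variable {V : Type*} [AddCommGroup V] [Module ℝ V] [TopologicalSpace V]

lemma mul_domCoprod_summand {a b : ℕ} (f : V [⋀^Fin a]→L[ℝ] ℝ) (g : V [⋀^Fin b]→L[ℝ] ℝ)
    (σ : Equiv.Perm (Fin a ⊕ Fin b)) (w : Fin a ⊕ Fin b → V) :
    LinearMap.mul' ℝ ℝ (AlternatingMap.domCoprod.summand f.toAlternatingMap g.toAlternatingMap
      (Quotient.mk'' σ) w) = ((Equiv.Perm.sign σ : ℤ) : ℝ) *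
        (f (fun i => w (σ (Sum.inl i))) * g (fun i => w (σ (Sum.inr i)))) := by
  rw [AlternatingMap.domCoprod.summand_mk'']
  change LinearMap.mul' ℝ ℝ (Equiv.Perm.sign σ •
    ((f fun i => w (σ (Sum.inl i))) ⊗ₜ[ℝ] (g fun i => w (σ (Sum.inr i))))) = _
  rw [Units.smul_def, map_zsmul, zsmul_eq_mul, LinearMap.mul'_apply]

/-- The wedge product of alternating forms on a topological vector space,
`(f ∧ g)(v) = ∑ sign(σ) f(v_σ(1), …, v_σ(a)) g(v_σ(a+1), …, v_σ(a+b))` over `(a, b)`-shuffles. -/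
def altWedge {a b : ℕ} (f : V [⋀^Fin a]→L[ℝ] ℝ) (g : V [⋀^Fin b]→L[ℝ] ℝ) :
    V [⋀^Fin (a + b)]→L[ℝ] ℝ :=
  { ((LinearMap.mul' ℝ ℝ).compAlternatingMap
      (f.toAlternatingMap.domCoprod g.toAlternatingMap)).domDomCongr finSumFinEquiv with
    cont := by
      change Continuous fun v : Fin (a + b) → V => LinearMap.mul' ℝ ℝ
        ((f.toAlternatingMap.domCoprod g.toAlternatingMap) fun i => v (finSumFinEquiv i))
      simp only [AlternatingMap.domCoprod_apply, _root_.sum_apply, map_sum]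
      refine continuous_finsetSum _ fun σ _ => ?_
      induction σ using Quotient.inductionOn' with | _ σ
      simp only [mul_domCoprod_summand]
      refine continuous_const.mul (Continuous.mul ?_ ?_)
      · exact f.cont.comp (continuous_pi fun i => continuous_apply _)
      · exact g.cont.comp (continuous_pi fun i => continuous_apply _) }

lemma altWedge_apply {a b : ℕ} (f : V [⋀^Fin a]→L[ℝ] ℝ) (g : V [⋀^Fin b]→L[ℝ] ℝ)
    (v : Fin (a + b) → V) :
    altWedge f g v = LinearMap.mul' ℝ ℝ
        ((f.toAlternatingMap.domCoprod g.toAlternatingMap) fun i => v (finSumFinEquiv i)) := rfl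

lemma altWedge_eq_sum {a b : ℕ} (f : V [⋀^Fin a]→L[ℝ] ℝ) (g : V [⋀^Fin b]→L[ℝ] ℝ)
    (v : Fin (a + b) → V) :
    altWedge f g v = ∑ σ : Equiv.Perm.ModSumCongr (Fin a) (Fin b), LinearMap.mul' ℝ ℝ
        (AlternatingMap.domCoprod.summand f.toAlternatingMap g.toAlternatingMap σ
          fun i => v (finSumFinEquiv i)) := by
  simp only [altWedge_apply, AlternatingMap.domCoprod_apply, _root_.sum_apply, map_sum]

lemma altWedge_comp {W : Type*} [AddCommGroup W] [Module ℝ W] [TopologicalSpace W] {a b : ℕ}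
    (f : V [⋀^Fin a]→L[ℝ] ℝ) (g : V [⋀^Fin b]→L[ℝ] ℝ) (A : W →L[ℝ] V) :
    (altWedge f g).compContinuousLinearMap A =
      altWedge (f.compContinuousLinearMap A) (g.compContinuousLinearMap A) := by
  ext v
  rw [ContinuousAlternatingMap.compContinuousLinearMap_apply, altWedge_eq_sum, altWedge_eq_sum]
  refine Finset.sum_congr rfl fun σ _ => ?_
  induction σ using Quotient.inductionOn' with | _ σ
  rw [mul_domCoprod_summand, mul_domCoprod_summand]
  rfl

end Wedge

section Smooth

variable {E : Type*} [NormedAddCommGroup E] [NormedSpace ℝ E] [FiniteDimensional ℝ E]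

lemma finiteDimensional_alternating (k : ℕ) : FiniteDimensional ℝ (E [⋀^Fin k]→L[ℝ] ℝ) := by
  let L : (E [⋀^Fin k]→L[ℝ] ℝ) →ₗ[ℝ] MultilinearMap ℝ (fun _ : Fin k => E) ℝ :=
    { toFun := fun f => f.toMultilinearMap
      map_add' := fun _ _ => rfl
      map_smul' := fun _ _ => rfl }
  refine FiniteDimensional.of_injective L fun f g h => ?_
  ext v
  exact congrArg (fun F : MultilinearMap ℝ (fun _ : Fin k => E) ℝ => F v) h

/-- The wedge product as a bilinear map. -/
def altWedgeₗ (E : Type*) [NormedAddCommGroup E] [NormedSpace ℝ E] (a b : ℕ) :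
    (E [⋀^Fin a]→L[ℝ] ℝ) →ₗ[ℝ] (E [⋀^Fin b]→L[ℝ] ℝ) →ₗ[ℝ] (E [⋀^Fin (a + b)]→L[ℝ] ℝ) := by
  refine LinearMap.mk₂ ℝ altWedge ?_ ?_ ?_ ?_ <;> intros <;> ext v <;>
    simp only [ContinuousAlternatingMap.add_apply, ContinuousAlternatingMap.smul_apply,
      altWedge_eq_sum, ← Finset.sum_add_distrib, Finset.smul_sum] <;>
    refine Finset.sum_congr rfl fun σ _ => ?_ <;>
    induction σ using Quotient.inductionOn' <;>
    simp only [mul_domCoprod_summand, ContinuousAlternatingMap.add_apply,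
      ContinuousAlternatingMap.smul_apply, smul_eq_mul] <;> ring

lemma contDiffOn_altWedge {a b : ℕ} {r : WithTop ℕ∞} {s : Set E} {f : E → E [⋀^Fin a]→L[ℝ] ℝ}
    {g : E → E [⋀^Fin b]→L[ℝ] ℝ} (hf : ContDiffOn ℝ r f s) (hg : ContDiffOn ℝ r g s) :
    ContDiffOn ℝ r (fun y => altWedge (f y) (g y)) s := by
  have := finiteDimensional_alternating (E := E) a
  have := finiteDimensional_alternating (E := E) b
  obtain ⟨B, hB⟩ : ∃ B : (E [⋀^Fin a]→L[ℝ] ℝ) →L[ℝ] (E [⋀^Fin b]→L[ℝ] ℝ) →L[ℝ]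
      (E [⋀^Fin (a + b)]→L[ℝ] ℝ), ∀ f g, B f g = altWedge f g :=
    ⟨(altWedgeₗ E a b).toContinuousBilinearMap, fun f g => by
      rw [LinearMap.toContinuousBilinearMap_apply]; rfl⟩
  simp only [← hB]
  exact (B.contDiff.comp_contDiffOn hf).clm_apply hg

end Smooth

/-! ### Differential forms -/

section Forms

variable (E : Type*) [NormedAddCommGroup E] [NormedSpace ℝ E]
  (M : Type*) [TopologicalSpace M] [ChartedSpace E M]

/-- A (not necessarily smooth) differential `k`-form on `M`. -/
abbrev RawForm (k : ℕ) : Type _ := (x : M) → TangentSpace 𝓘(ℝ, E) x [⋀^Fin k]→L[ℝ] ℝ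

variable {E M}

/-- The coordinate expression of a form in the preferred chart `φ` around `x₀`: its pullback by
`φ⁻¹`. It is meaningful on `φ.target`. -/
def formInChart {k : ℕ} (α : RawForm E M k) (x₀ : M) (y : E) : E [⋀^Fin k]→L[ℝ] ℝ :=
  (α ((chartAt E x₀).symm y)).compContinuousLinearMap
    (mfderiv 𝓘(ℝ, E) 𝓘(ℝ, E) (chartAt E x₀).symm y)

variable (E M)

/-- The space of forms of class `C^r`, as a subspace of all forms. -/
def diffFormSubmodule (r : WithTop ℕ∞) (k : ℕ) : Submodule ℝ (RawForm E M k) where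
  carrier := {α | ∀ x₀ : M, ContDiffOn ℝ r (formInChart α x₀) (chartAt E x₀).target}
  add_mem' hα hβ x₀ := (hα x₀).add (hβ x₀)
  zero_mem' _ := contDiffOn_const (c := 0)
  smul_mem' c _ hα x₀ := (hα x₀).const_smul c

/-- The space of `C^r` differential `k`-forms on `M`; for `r = ∞` these are the smooth forms. -/
def DiffForm (r : WithTop ℕ∞) (k : ℕ) : Type _ := diffFormSubmodule E M r k

instance (r : WithTop ℕ∞) (k : ℕ) : AddCommGroup (DiffForm E M r k) :=
  inferInstanceAs (AddCommGroup (diffFormSubmodule E M r k))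

instance (r : WithTop ℕ∞) (k : ℕ) : Module ℝ (DiffForm E M r k) :=
  inferInstanceAs (Module ℝ (diffFormSubmodule E M r k))

/-- The `C^r` topology (for `r = ∞`, the usual Fréchet topology): uniform convergence, on compact
subsets of chart domains, of the coordinate expressions together with their derivatives of every
finite order `j ≤ r`. -/
instance (r : WithTop ℕ∞) (k : ℕ) : TopologicalSpace (DiffForm E M r k) :=
  ⨅ (x₀ : M) (j : ℕ) (_ : (j : WithTop ℕ∞) ≤ r),
    TopologicalSpace.induced
      (fun α : DiffForm E M r k =>
        UniformOnFun.ofFun {K : Set E | IsCompact K ∧ K ⊆ (chartAt E x₀).target}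
          (iteratedFDeriv ℝ j (formInChart α.1 x₀)))
      inferInstance

variable {E M}

/-- The inclusion of smooth forms in `C^r` forms, for finite `r`. -/
def DiffForm.ofSmooth (r : ℕ) {k : ℕ} (α : DiffForm E M ∞ k) : DiffForm E M r k :=
  ⟨α.1, fun x₀ => (α.2 x₀).of_le (by exact_mod_cast le_top)⟩

/-- The constant function `1`, a smooth `0`-form. -/
def DiffForm.one : DiffForm E M ∞ 0 :=
  ⟨fun x => ContinuousAlternatingMap.constOfIsEmpty ℝ (TangentSpace 𝓘(ℝ, E) x) (Fin 0) (1 : ℝ),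
    fun _ => contDiffOn_const
      (c := ContinuousAlternatingMap.constOfIsEmpty ℝ E (Fin 0) (1 : ℝ))⟩

/-- The wedge product of smooth forms. -/
def DiffForm.wedge [FiniteDimensional ℝ E] {a b : ℕ} (α : DiffForm E M ∞ a)
    (β : DiffForm E M ∞ b) : DiffForm E M ∞ (a + b) :=
  ⟨fun x => altWedge (α.1 x) (β.1 x), fun x₀ =>
    (contDiffOn_altWedge (α.2 x₀) (β.2 x₀)).congr fun _ _ => altWedge_comp _ _ _⟩

/-- The exterior derivative of a form, computed at `x` in the preferred chart around `x`. -/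
def extDerivForm {k : ℕ} (α : RawForm E M k) : RawForm E M (k + 1) := fun x =>
  (extDeriv (formInChart α x) (chartAt E x x)).compContinuousLinearMap
    (mfderiv 𝓘(ℝ, E) 𝓘(ℝ, E) (chartAt E x) x)

/-- The exterior derivative is given by the usual formula in every chart. -/
lemma formInChart_extDerivForm [IsManifold 𝓘(ℝ, E) ∞ M] {k : ℕ} (α : DiffForm E M ∞ k) (x₀ : M)
    {y : E} (hy : y ∈ (chartAt E x₀).target) :
    formInChart (extDerivForm α.1) x₀ y = extDeriv (formInChart α.1 x₀) y := by
  set φ := chartAt E x₀ with hφ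
  set x : M := φ.symm y with hx
  set ψ := chartAt E x with hψ
  have hxψ : x ∈ ψ.source := mem_chart_source E x
  let τ : E → E := fun z => ψ (φ.symm z)
  have hne : (∞ : WithTop ℕ∞) ≠ 0 := by simp
  -- near `y`, the inverse chart maps into the domain of `ψ`
  have hφd : ∀ z ∈ φ.target, MDifferentiableAt 𝓘(ℝ, E) 𝓘(ℝ, E) φ.symm z := fun z hz =>
    ((contMDiffOn_chart_symm (I := 𝓘(ℝ, E)) (n := ∞) (x := x₀)).contMDiffAt
      (φ.open_target.mem_nhds hz)).mdifferentiableAt hne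
  have hψc : ∀ q ∈ ψ.source, ContMDiffAt 𝓘(ℝ, E) 𝓘(ℝ, E) ∞ ψ q := fun q hq =>
    (contMDiffOn_chart (I := 𝓘(ℝ, E)) (n := ∞) (x := x)).contMDiffAt (ψ.open_source.mem_nhds hq)
  have hψd : ∀ q ∈ ψ.source, MDifferentiableAt 𝓘(ℝ, E) 𝓘(ℝ, E) ψ q := fun q hq =>
    (hψc q hq).mdifferentiableAt hne
  have hψsd : ∀ z ∈ ψ.target, MDifferentiableAt 𝓘(ℝ, E) 𝓘(ℝ, E) ψ.symm z := fun z hz =>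
    ((contMDiffOn_chart_symm (I := 𝓘(ℝ, E)) (n := ∞) (x := x)).contMDiffAt
      (ψ.open_target.mem_nhds hz)).mdifferentiableAt hne
  have hnear : ∀ᶠ z in 𝓝 y, z ∈ φ.target ∧ φ.symm z ∈ ψ.source :=
    (φ.open_target.mem_nhds hy |> fun h => Filter.Eventually.and h
      ((φ.continuousAt_symm hy).eventually (ψ.open_source.mem_nhds hxψ)))
  have hτd : ∀ z, z ∈ φ.target → φ.symm z ∈ ψ.source →
      fderiv ℝ τ z = (mfderiv 𝓘(ℝ, E) 𝓘(ℝ, E) ψ (φ.symm z)).comp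
        (mfderiv 𝓘(ℝ, E) 𝓘(ℝ, E) φ.symm z) := fun z hz hz' => by
    rw [← mfderiv_eq_fderiv]
    exact mfderiv_comp z (hψd _ hz') (hφd z hz)
  have hτ : ContDiffAt ℝ ∞ τ y := by
    rw [← contMDiffAt_iff_contDiffAt]
    exact (hψc x hxψ).comp y ((contMDiffOn_chart_symm (I := 𝓘(ℝ, E)) (n := ∞)
      (x := x₀)).contMDiffAt (φ.open_target.mem_nhds hy))
  have hpull : (fun z => (formInChart α.1 x (τ z)).compContinuousLinearMap (fderiv ℝ τ z))
      =ᶠ[𝓝 y] formInChart α.1 x₀ := by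
    filter_upwards [hnear] with z hz
    obtain ⟨hz, hz'⟩ := hz
    have hback : ψ.symm (τ z) = φ.symm z := ψ.left_inv hz'
    have hτz : MDifferentiableAt 𝓘(ℝ, E) 𝓘(ℝ, E) τ z := (hψd _ hz').comp z (hφd z hz)
    have hcomp : (ψ.symm ∘ τ) =ᶠ[𝓝 z] φ.symm := by
      filter_upwards [(φ.continuousAt_symm hz).eventually (ψ.open_source.mem_nhds hz')] with w hw
      exact ψ.left_inv hw
    have hchain := mfderiv_comp z (hψsd (τ z) (ψ.map_source hz')) hτz
    rw [hcomp.mfderiv_eq, mfderiv_eq_fderiv] at hchain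
    let G : M → E [⋀^Fin k]→L[ℝ] ℝ := α.1
    have key : ∀ (q q' : M) (_ : q = q') (A B : E →L[ℝ] E) (_ : A = B),
        (G q).compContinuousLinearMap A = (G q').compContinuousLinearMap B := by
      rintro q _ rfl A _ rfl; rfl
    exact key _ _ hback _ _ hchain.symm
  rw [← hpull.extDeriv_eq]
  have hτy : τ y = ψ x := rfl
  rw [extDeriv_pullback (r := ∞) ?_ hτ (by simpa using WithTop.coe_le_coe.2 (le_top : (2 : ℕ∞) ≤ ⊤))]
  · rw [hτd y hy hxψ]
    rfl
  · exact ((α.2 x).contDiffAt (ψ.open_target.mem_nhds (ψ.map_source hxψ))).differentiableAt hne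

/-- The exterior derivative of smooth forms. -/
def DiffForm.d [IsManifold 𝓘(ℝ, E) ∞ M] {k : ℕ} (α : DiffForm E M ∞ k) :
    DiffForm E M ∞ (k + 1) :=
  ⟨extDerivForm α.1, fun x₀ => by
    have h : ContDiffOn ℝ ∞ (fderiv ℝ (formInChart α.1 x₀)) (chartAt E x₀).target :=
      (α.2 x₀).fderiv_of_isOpen (chartAt E x₀).open_target (by simp)
    refine ContDiffOn.congr (f := fun y => ContinuousAlternatingMap.alternatizeUncurryFinCLM ℝ E ℝ
      (fderiv ℝ (formInChart α.1 x₀) y)) ?_ fun y hy => formInChart_extDerivForm α x₀ hy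
    exact (ContinuousLinearMap.contDiff _).comp_contDiffOn h⟩

end Forms

/-! ### Currents supported at a point -/

section Currents

variable (E : Type*) [NormedAddCommGroup E] [NormedSpace ℝ E]
  {M : Type*} [TopologicalSpace M] [ChartedSpace E M]

/-- The degree `k` part of the fibre at `p`: the compactly supported de Rham currents of dimension
`k` (continuous linear functionals on smooth `k`-forms) with support contained in `{p}`. -/
def atomicCurrents (p : M) (k : ℕ) : Submodule ℝ (DiffForm E M ∞ k →L[ℝ] ℝ) where
  carrier := {T | ∀ α : DiffForm E M ∞ k, (∀ᶠ x in 𝓝 p, α.1 x = 0) → T α = 0}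
  add_mem' hT hS α hα := by simp [hT α hα, hS α hα]
  zero_mem' _ _ := rfl
  smul_mem' c _ hT α hα := by simp [hT α hα]

/-- The currents at `p` of dimension `k` and order at most `r`: those that extend to a continuous
linear functional on the space of `C^r` forms. -/
def orderFiltration (p : M) (k r : ℕ) : Submodule ℝ (atomicCurrents E p k) where
  carrier := {T | ∃ S : DiffForm E M r k →L[ℝ] ℝ, ∀ α : DiffForm E M ∞ k,
    S (α.ofSmooth r) = T.1 α}
  add_mem' := by
    rintro _ _ ⟨S, hS⟩ ⟨S', hS'⟩
    exact ⟨S + S', fun α => by simp [hS, hS']⟩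
  zero_mem' := ⟨0, fun _ => rfl⟩
  smul_mem' := by
    rintro c _ ⟨S, hS⟩
    exact ⟨c • S, fun α => by simp [hS]⟩

variable {E}

/-- Evaluation of a current at `p` of mixed dimension on a smooth `k`-form (only the component of
dimension `k` contributes). -/
def evalForm (p : M) {k : ℕ} (α : DiffForm E M ∞ k) :
    (⨁ k, atomicCurrents E p k) →ₗ[ℝ] ℝ :=
  { toFun := fun T : atomicCurrents E p k => T.1 α
    map_add' := fun _ _ => rfl
    map_smul' := fun _ _ => rfl } ∘ₗ DirectSum.component ℝ ℕ (fun k => atomicCurrents E p k) k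

/-- The pairing of `α ⊗ β` with an element of the tensor square of the fibre at `p`,
`(α ⊗ β)(S ⊗ T) = α(S) β(T)`. -/
def evalTensor (p : M) {a b : ℕ} (α : DiffForm E M ∞ a) (β : DiffForm E M ∞ b) :
    (⨁ k, atomicCurrents E p k) ⊗[ℝ] (⨁ k, atomicCurrents E p k) →ₗ[ℝ] ℝ :=
  LinearMap.mul' ℝ ℝ ∘ₗ TensorProduct.map (evalForm p α) (evalForm p β)

end Currents

end

/-! Everything is dual to the algebra of smooth forms, filtered by order of vanishing at `p`. Let `J
k s` be the `k`-forms whose Taylor coefficients of order less than `s` vanish at `p`. These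
subspaces have finite codimension, the wedge product sends `J a s × J b t` into `J (a + b) (s + t)`,
and `d` lowers `s` by one (`wedge_mem_vanishingForms`, `d_mem_vanishingForms`).

The analytic core is that a current at `p` has order at most `r` exactly when it annihilates `J k (r
+ 1)` (`mem_orderFiltration_iff`), and that every current at `p` has finite order
(`exists_mem_orderFiltration`). A functional on the finite-dimensional space of jets is
automatically continuous on `C^r` forms. Conversely, a form with vanishing `r`-jet can be cut off at
scale `ε` around `p` to become `C^r`-small (`exists_small_cutoff`) without changing the value of the
current.

The algebraic core is the existence of the coproduct. The full dual of an infinite-dimensional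
algebra is not a coalgebra, but here `(α, β) ↦ T (α ∧ β)` kills `J a s × J b t` whenever `s + t = r
+ 1`. It therefore has finite rank and is a sum of products of functionals of orders `s` and `t`
with `s + t = r` (`exists_tensor_of_filtered_bilinear`). Pairs of forms separate the points of the
tensor square (`tensor_eq_zero_of_separating`), so the coproduct is unique and linear.
Co-associativity, the co-unit laws and the co-derivation rule are then the transposes of
associativity, unitality and the Leibniz rule for forms. The structure `FilteredDuality` isolates
what this argument uses. -/

noncomputable section

/-! ### Signed sums over permutations -/

section SignedSums

variable {V : Type*} {ι κ : Type*} [Fintype ι] [DecidableEq ι] [Fintype κ] [DecidableEq κ]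

/-- The signed sum of a function of a family of vectors over all permutations of the family. -/
def signedSum (F : (ι → V) → ℝ) (w : ι → V) : ℝ :=
  ∑ σ : Equiv.Perm ι, ((Equiv.Perm.sign σ : ℤ) : ℝ) * F (w ∘ σ)

lemma signedSum_congr {F G : (ι → V) → ℝ} (h : ∀ w, F w = G w) (w : ι → V) :
    signedSum F w = signedSum G w := by
  simp only [signedSum, h]

lemma signedSum_const_mul (c : ℝ) (F : (ι → V) → ℝ) (w : ι → V) :
    signedSum (fun u => c * F u) w = c * signedSum F w := by
  simp only [signedSum, Finset.mul_sum]
  exact Finset.sum_congr rfl fun σ _ => by ring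

lemma signedSum_sum {α : Type*} (s : Finset α) (F : α → (ι → V) → ℝ) (w : ι → V) :
    signedSum (fun u => ∑ i ∈ s, F i u) w = ∑ i ∈ s, signedSum (F i) w := by
  simp only [signedSum, Finset.mul_sum]
  exact Finset.sum_comm

lemma signedSum_reindex (e : ι ≃ κ) (F : (ι → V) → ℝ) (w : κ → V) :
    signedSum F (w ∘ e) = signedSum (fun u => F (u ∘ e)) w := by
  simp only [signedSum]
  rw [← Equiv.sum_comp e.permCongr]
  refine Finset.sum_congr rfl fun σ _ => ?_
  rw [Equiv.Perm.sign_permCongr]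
  congr 2
  funext i
  simp [Equiv.permCongr_apply]

lemma signedSum_comp_perm (τ : Equiv.Perm ι) (F : (ι → V) → ℝ) (w : ι → V) :
    signedSum (fun u => F (u ∘ τ)) w = ((Equiv.Perm.sign τ : ℤ) : ℝ) * signedSum F w := by
  simp only [signedSum, Finset.mul_sum]
  rw [← Equiv.sum_comp (Equiv.mulRight τ⁻¹)]
  refine Finset.sum_congr rfl fun σ _ => ?_
  simp only [Equiv.coe_mulRight, Equiv.Perm.sign_mul, Equiv.Perm.sign_inv, Units.val_mul,
    Int.cast_mul]
  have : (w ∘ ⇑(σ * τ⁻¹)) ∘ ⇑τ = w ∘ σ := by funext i; simp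
  rw [this]; ring

/-- A permutation of the left block extends by the identity to the whole family, with the same sign.
Absorbing it into the outer sum makes the two signs cancel, so every inner permutation contributes
the same amount. -/
lemma signedSum_signedSum_inl (H : (ι → V) → (κ → V) → ℝ) (w : ι ⊕ κ → V) :
    signedSum (fun u : ι ⊕ κ → V => signedSum (fun x => H x (u ∘ Sum.inr)) (u ∘ Sum.inl)) w =
      (Fintype.card ι).factorial * signedSum (fun u : ι ⊕ κ → V =>
        H (u ∘ Sum.inl) (u ∘ Sum.inr)) w := by
  have key : ∀ ρ : Equiv.Perm ι, signedSum (fun u : ι ⊕ κ → V =>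
      ((Equiv.Perm.sign ρ : ℤ) : ℝ) * H ((u ∘ Sum.inl) ∘ ρ) (u ∘ Sum.inr)) w =
      signedSum (fun u : ι ⊕ κ → V => H (u ∘ Sum.inl) (u ∘ Sum.inr)) w := fun ρ => by
    rw [signedSum_const_mul]
    have := signedSum_comp_perm (Equiv.Perm.sumCongr ρ (1 : Equiv.Perm κ))
      (fun u : ι ⊕ κ → V => H (u ∘ Sum.inl) (u ∘ Sum.inr)) w
    rw [Equiv.Perm.sign_sumCongr] at this
    simp only [Equiv.Perm.sign_one, mul_one] at this
    rw [← one_mul (signedSum (fun u : ι ⊕ κ → V => H (u ∘ Sum.inl) (u ∘ Sum.inr)) w),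
      show (1 : ℝ) = ((Equiv.Perm.sign ρ : ℤ) : ℝ) * ((Equiv.Perm.sign ρ : ℤ) : ℝ) by
        rcases Int.units_eq_one_or (Equiv.Perm.sign ρ) with h | h <;> simp [h], mul_assoc, ← this]
    rfl
  conv_lhs => enter [1, u]; rw [signedSum]
  rw [signedSum_sum, Finset.sum_congr rfl fun ρ _ => key ρ]
  simp [Fintype.card_perm]

lemma signedSum_signedSum_inr (H : (ι → V) → (κ → V) → ℝ) (w : ι ⊕ κ → V) :
    signedSum (fun u : ι ⊕ κ → V => signedSum (fun x => H (u ∘ Sum.inl) x) (u ∘ Sum.inr)) w =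
      (Fintype.card κ).factorial * signedSum (fun u : ι ⊕ κ → V =>
        H (u ∘ Sum.inl) (u ∘ Sum.inr)) w := by
  have h1 := signedSum_reindex (Equiv.sumComm κ ι)
    (fun u : κ ⊕ ι → V => signedSum (fun x => H (u ∘ Sum.inr) x) (u ∘ Sum.inl)) w
  have h2 := signedSum_reindex (Equiv.sumComm κ ι)
    (fun u : κ ⊕ ι → V => H (u ∘ Sum.inr) (u ∘ Sum.inl)) w
  exact h1.symm.trans ((signedSum_signedSum_inl (fun x y => H y x) (w ∘ Equiv.sumComm κ ι)).trans
    (congrArg _ h2))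

/-- This is the block identity with a single vector on the left. It serves exterior derivatives,
where the direction of differentiation occupies slot `0`. -/
lemma signedSum_signedSum_succ {n : ℕ} (H : V → (Fin n → V) → ℝ)
    (v : Fin (n + 1) → V) :
    signedSum (fun u : Fin (n + 1) → V => signedSum (H (u 0)) (fun i => u i.succ)) v =
      n.factorial * signedSum (fun u : Fin (n + 1) → V => H (u 0) (fun i => u i.succ)) v := by
  have h := signedSum_signedSum_inr (fun (x : Fin 1 → V) (y : Fin n → V) => H (x 0) y)
    (v ∘ (finSumFinEquiv.trans (finCongr (add_comm 1 n))))
  rw [signedSum_reindex, signedSum_reindex, Fintype.card_fin] at h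
  have e : ∀ i : Fin n, (finSumFinEquiv.trans (finCongr (add_comm 1 n))) (Sum.inr i) = i.succ :=
    fun i => Fin.ext (by simp)
  have e' : (finSumFinEquiv.trans (finCongr (add_comm 1 n))) (Sum.inl 0) = 0 :=
    Fin.ext (by simp)
  simpa only [Function.comp_def, e, e'] using h

end SignedSums

/-! ### Associativity and unit laws of the wedge product, via full antisymmetrization -/

section WedgeAlgebra

variable {V : Type*} [AddCommGroup V] [Module ℝ V] [TopologicalSpace V]

lemma signedSum_alternating {n : ℕ} (f : V [⋀^Fin n]→L[ℝ] ℝ) (w : Fin n → V) :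
    signedSum f w = n.factorial * f w := by
  have h : ∀ σ : Equiv.Perm (Fin n), ((Equiv.Perm.sign σ : ℤ) : ℝ) * f (w ∘ σ) = f w := fun σ => by
    have := f.toAlternatingMap.map_perm w σ
    change f (w ∘ σ) = Equiv.Perm.sign σ • f w at this
    rw [this]
    rcases Int.units_eq_one_or (Equiv.Perm.sign σ) with h | h <;> simp [h, Units.smul_def]
  simp [signedSum, h, Fintype.card_perm]

/-- Shuffles represent the cosets of the block permutations, and each coset contributes `a! b!`
equal terms. Over the reals the factorials cancel, so identities between wedge products can be
checked on sums over all permutations. -/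
lemma signedSum_tensor_eq_altWedge {a b : ℕ} (f : V [⋀^Fin a]→L[ℝ] ℝ) (g : V [⋀^Fin b]→L[ℝ] ℝ)
    (v : Fin (a + b) → V) :
    signedSum (fun u : Fin a ⊕ Fin b → V => f (u ∘ Sum.inl) * g (u ∘ Sum.inr))
      (v ∘ finSumFinEquiv) = (a.factorial * b.factorial) * altWedge f g v := by
  have h := MultilinearMap.domCoprod_alternization_eq f.toAlternatingMap g.toAlternatingMap
  have h' := congrArg (fun F => LinearMap.mul' ℝ ℝ (F (v ∘ finSumFinEquiv))) h
  simp only [MultilinearMap.alternatization_apply, AlternatingMap.smul_apply, map_sum, map_nsmul,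
    Fintype.card_fin] at h'
  rw [altWedge_apply]
  have h3 : ((a.factorial * b.factorial : ℕ) : ℝ) * LinearMap.mul' ℝ ℝ
      ((f.toAlternatingMap.domCoprod g.toAlternatingMap) (v ∘ finSumFinEquiv)) = _ :=
    (nsmul_eq_mul _ _).symm.trans h'.symm
  push_cast at h3
  refine Eq.trans ?_ h3.symm
  refine Finset.sum_congr rfl fun σ _ => ?_
  rw [Units.smul_def, map_zsmul, zsmul_eq_mul]
  rfl


lemma altWedge_altWedge_left {a b c : ℕ} (f : V [⋀^Fin a]→L[ℝ] ℝ) (g : V [⋀^Fin b]→L[ℝ] ℝ)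
    (h : V [⋀^Fin c]→L[ℝ] ℝ) (v : Fin (a + b + c) → V) :
    (a.factorial * b.factorial * c.factorial) * altWedge (altWedge f g) h v =
      signedSum (fun u : Fin (a + b + c) → V => f (fun i => u (Fin.castAdd c (Fin.castAdd b i))) *
        g (fun i => u (Fin.castAdd c (Fin.natAdd a i))) * h (fun i => u (Fin.natAdd (a + b) i))) v := by
  -- The extra `(a + b)!` pays for replacing the inner wedge, evaluated on the first block, by its
  -- own signed sum.
  have h0 : ((a + b).factorial : ℝ) ≠ 0 := by positivity
  refine mul_left_cancel₀ h0 ?_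
  rw [show ((a + b).factorial : ℝ) * (a.factorial * b.factorial * c.factorial *
    altWedge (altWedge f g) h v) = (a.factorial * b.factorial) * ((a + b).factorial * c.factorial *
    altWedge (altWedge f g) h v) by ring, ← signedSum_tensor_eq_altWedge, ← signedSum_const_mul]
  have h1 := signedSum_signedSum_inl (fun (x : Fin (a + b) → V) (y : Fin c → V) =>
    f (x ∘ finSumFinEquiv ∘ Sum.inl) * g (x ∘ finSumFinEquiv ∘ Sum.inr) * h y) (v ∘ finSumFinEquiv)
  rw [Fintype.card_fin, signedSum_reindex, signedSum_reindex] at h1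
  rw [signedSum_reindex]
  refine Eq.trans (signedSum_congr (fun w => ?_) v) h1
  rw [← mul_assoc, ← signedSum_tensor_eq_altWedge, signedSum_reindex, mul_comm,
    ← signedSum_const_mul]
  exact signedSum_congr (fun x => mul_comm _ _) _

lemma altWedge_altWedge_right {a b c : ℕ} (f : V [⋀^Fin a]→L[ℝ] ℝ) (g : V [⋀^Fin b]→L[ℝ] ℝ)
    (h : V [⋀^Fin c]→L[ℝ] ℝ) (v : Fin (a + (b + c)) → V) :
    (a.factorial * b.factorial * c.factorial) * altWedge f (altWedge g h) v =
      signedSum (fun u : Fin (a + (b + c)) → V => f (fun i => u (Fin.castAdd (b + c) i)) *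
        g (fun i => u (Fin.natAdd a (Fin.castAdd c i))) *
        h (fun i => u (Fin.natAdd a (Fin.natAdd b i)))) v := by
  have h0 : ((b + c).factorial : ℝ) ≠ 0 := by positivity
  refine mul_left_cancel₀ h0 ?_
  rw [show ((b + c).factorial : ℝ) * (a.factorial * b.factorial * c.factorial *
    altWedge f (altWedge g h) v) = (b.factorial * c.factorial) * (a.factorial * (b + c).factorial *
    altWedge f (altWedge g h) v) by ring, ← signedSum_tensor_eq_altWedge, ← signedSum_const_mul]
  have h1 := signedSum_signedSum_inr (fun (x : Fin a → V) (y : Fin (b + c) → V) =>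
    f x * g (y ∘ finSumFinEquiv ∘ Sum.inl) * h (y ∘ finSumFinEquiv ∘ Sum.inr)) (v ∘ finSumFinEquiv)
  rw [Fintype.card_fin, signedSum_reindex, signedSum_reindex] at h1
  rw [signedSum_reindex]
  refine Eq.trans (signedSum_congr (fun w => ?_) v) h1
  rw [mul_left_comm, ← signedSum_tensor_eq_altWedge, signedSum_reindex, ← signedSum_const_mul]
  exact signedSum_congr (fun x => (mul_assoc _ _ _).symm) _

/-- The wedge product is associative. -/
lemma altWedge_assoc {a b c : ℕ} (f : V [⋀^Fin a]→L[ℝ] ℝ) (g : V [⋀^Fin b]→L[ℝ] ℝ)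
    (h : V [⋀^Fin c]→L[ℝ] ℝ) (v : Fin (a + (b + c)) → V) :
    altWedge (altWedge f g) h (v ∘ finCongr (add_assoc a b c)) = altWedge f (altWedge g h) v := by
  have h0 : (a.factorial * b.factorial * c.factorial : ℝ) ≠ 0 := by positivity
  refine mul_left_cancel₀ h0 ?_
  rw [altWedge_altWedge_left, altWedge_altWedge_right, signedSum_reindex]
  refine signedSum_congr (fun w => ?_) v
  congr 1
  congr 1
  funext i
  exact congrArg w (Fin.ext (by simp [add_assoc]))

/-- After multiplication by `b!` both sides are the signed sum of `g`. The reindexing is needed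
because `0 + b` is not definitionally `b`, unlike `b + 0` in `altWedge_one`. -/
lemma one_altWedge {b : ℕ} (g : V [⋀^Fin b]→L[ℝ] ℝ) (v : Fin b → V) :
    altWedge (ContinuousAlternatingMap.constOfIsEmpty ℝ V (Fin 0) (1 : ℝ)) g
      (v ∘ finCongr (zero_add b)) = g v := by
  have h0 : (b.factorial : ℝ) ≠ 0 := by positivity
  refine mul_left_cancel₀ h0 ?_
  have h1 := signedSum_tensor_eq_altWedge
    (ContinuousAlternatingMap.constOfIsEmpty ℝ V (Fin 0) (1 : ℝ)) g (v ∘ finCongr (zero_add b))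
  rw [Nat.factorial_zero, Nat.cast_one, one_mul] at h1
  rw [← h1, ← signedSum_alternating, signedSum_reindex, signedSum_reindex]
  refine signedSum_congr (fun w => ?_) v
  simp only [ContinuousAlternatingMap.constOfIsEmpty_apply, one_mul]
  refine congrArg g (funext fun i => congrArg w (Fin.ext (by simp)))

lemma altWedge_one {b : ℕ} (g : V [⋀^Fin b]→L[ℝ] ℝ) (v : Fin b → V) :
    altWedge g (ContinuousAlternatingMap.constOfIsEmpty ℝ V (Fin 0) (1 : ℝ)) v = g v := by
  have h0 : (b.factorial : ℝ) ≠ 0 := by positivity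
  refine mul_left_cancel₀ h0 ?_
  have h1 := signedSum_tensor_eq_altWedge g
    (ContinuousAlternatingMap.constOfIsEmpty ℝ V (Fin 0) (1 : ℝ)) v
  rw [Nat.factorial_zero, Nat.cast_one, mul_one] at h1
  rw [← h1, ← signedSum_alternating, signedSum_reindex]
  refine signedSum_congr (fun w => ?_) v
  simp only [ContinuousAlternatingMap.constOfIsEmpty_apply, mul_one]
  refine congrArg g (funext fun i => congrArg w (Fin.ext rfl))

end WedgeAlgebra

/-! ### Compatibility of the wedge product with antisymmetrized derivatives -/

section WedgeUncurry

variable {E : Type*} [NormedAddCommGroup E] [NormedSpace ℝ E]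

/-- The `i`-th term of the alternatization is the `0`-th one with its arguments permuted by a cycle
of sign `(-1) ^ i`. All `n + 1` terms thus have the same signed sum, and the factor `n + 1` cancels.
-/
lemma signedSum_eq_alternatizeUncurryFin {n : ℕ} (L : E →L[ℝ] E [⋀^Fin n]→L[ℝ] ℝ)
    (v : Fin (n + 1) → E) :
    signedSum (fun u : Fin (n + 1) → E => L (u 0) (fun i => u i.succ)) v =
      n.factorial * ContinuousAlternatingMap.alternatizeUncurryFin L v := by
  have h0 : ((n + 1 : ℕ) : ℝ) ≠ 0 := by positivity
  refine mul_left_cancel₀ h0 ?_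
  rw [← mul_assoc, ← Nat.cast_mul, ← Nat.factorial_succ, ← signedSum_alternating]
  have h1 : signedSum (ContinuousAlternatingMap.alternatizeUncurryFin L) v =
      signedSum (fun u => ∑ i : Fin (n + 1), (-1 : ℝ) ^ (i : ℕ) * L (u i) (i.removeNth u)) v := by
    refine signedSum_congr (fun w => ?_) v
    rw [ContinuousAlternatingMap.alternatizeUncurryFin_apply]
    exact Finset.sum_congr rfl fun i _ => by rw [zsmul_eq_mul]; push_cast; rfl
  rw [h1, signedSum_sum]
  have h2 : ∀ i : Fin (n + 1), signedSum (fun u => (-1 : ℝ) ^ (i : ℕ) * L (u i) (i.removeNth u)) v =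
      signedSum (fun u : Fin (n + 1) → E => L (u 0) (fun i => u i.succ)) v := fun i => by
    -- This cycle sends `0` to `i` and enumerates the remaining indices in increasing order.
    have h3 := signedSum_comp_perm i.cycleRange.symm
      (fun u : Fin (n + 1) → E => L (u 0) (fun i => u i.succ)) v
    have h4 : ∀ u : Fin (n + 1) → E, L ((u ∘ i.cycleRange.symm) 0)
        (fun j => (u ∘ i.cycleRange.symm) j.succ) = L (u i) (i.removeNth u) := fun u => by
      congr 2
      · simp
      · funext j
        simp [Fin.removeNth]
    simp only [h4] at h3
    rw [signedSum_const_mul, h3, ← mul_assoc]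
    simp [Equiv.Perm.sign_symm, ← mul_pow]
  rw [Finset.sum_congr rfl fun i _ => h2 i]
  simp

lemma factorial_mul_altWedge {a b : ℕ} (f : E [⋀^Fin a]→L[ℝ] ℝ) (g : E [⋀^Fin b]→L[ℝ] ℝ)
    (v : Fin (a + b) → E) :
    (a.factorial * b.factorial) * altWedge f g v = signedSum (fun u : Fin (a + b) → E =>
      f (fun i => u (Fin.castAdd b i)) * g (fun i => u (Fin.natAdd a i))) v := by
  rw [← signedSum_tensor_eq_altWedge, signedSum_reindex]
  rfl

/-- No sign appears: the differentiated slot is already in front of the arguments of the first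
factor, so both sides antisymmetrize the same function. -/
lemma alternatizeUncurryFin_altWedge_left {a b : ℕ} (L : E →L[ℝ] E [⋀^Fin a]→L[ℝ] ℝ)
    (g : E [⋀^Fin b]→L[ℝ] ℝ) (L' : E →L[ℝ] E [⋀^Fin (a + b)]→L[ℝ] ℝ)
    (hL' : ∀ x, L' x = altWedge (L x) g) (v : Fin (a + b + 1) → E) :
    ContinuousAlternatingMap.alternatizeUncurryFin L' v =
      altWedge (ContinuousAlternatingMap.alternatizeUncurryFin L) g
        (v ∘ finCongr (Nat.add_right_comm a 1 b)) := by
  have hl : (a.factorial * b.factorial : ℝ) * ContinuousAlternatingMap.alternatizeUncurryFin L' v =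
      signedSum (fun u : Fin (a + b + 1) → E => L (u 0) (fun i => u (Fin.castAdd b i).succ) *
        g (fun i => u (Fin.natAdd a i).succ)) v := by
    refine mul_left_cancel₀ (show ((a + b).factorial : ℝ) ≠ 0 by positivity) ?_
    rw [mul_left_comm, ← signedSum_eq_alternatizeUncurryFin, ← signedSum_const_mul]
    refine Eq.trans (signedSum_congr (fun w => ?_) v) (signedSum_signedSum_succ (fun x y =>
      L x (fun i => y (Fin.castAdd b i)) * g (fun i => y (Fin.natAdd a i))) v)
    rw [hL', factorial_mul_altWedge]
  have hr : (a.factorial * b.factorial : ℝ) * altWedge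
      (ContinuousAlternatingMap.alternatizeUncurryFin L) g
        (v ∘ finCongr (Nat.add_right_comm a 1 b)) =
      signedSum (fun u : Fin (a + 1 + b) → E => L (u (Fin.castAdd b 0))
        (fun i => u (Fin.castAdd b i.succ)) * g (fun i => u (Fin.natAdd (a + 1) i)))
        (v ∘ finCongr (Nat.add_right_comm a 1 b)) := by
    refine mul_left_cancel₀ (show ((a + 1).factorial : ℝ) ≠ 0 by positivity) ?_
    have h1 := signedSum_signedSum_inl (fun (x : Fin (a + 1) → E) (y : Fin b → E) =>
      L (x 0) (fun i => x i.succ) * g y)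
      ((v ∘ finCongr (Nat.add_right_comm a 1 b)) ∘ finSumFinEquiv)
    rw [Fintype.card_fin, signedSum_reindex finSumFinEquiv, signedSum_reindex finSumFinEquiv] at h1
    refine Eq.trans ?_ h1
    rw [show ((a + 1).factorial * (a.factorial * b.factorial * altWedge
      (ContinuousAlternatingMap.alternatizeUncurryFin L) g
        (v ∘ finCongr (Nat.add_right_comm a 1 b))) : ℝ) = a.factorial * ((a + 1).factorial *
        b.factorial * altWedge (ContinuousAlternatingMap.alternatizeUncurryFin L) g
        (v ∘ finCongr (Nat.add_right_comm a 1 b))) by ring, factorial_mul_altWedge,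
      ← signedSum_const_mul]
    refine signedSum_congr (fun w => ?_) _
    rw [← mul_assoc, ← signedSum_eq_alternatizeUncurryFin, mul_comm, ← signedSum_const_mul]
    exact signedSum_congr (fun _ => mul_comm _ _) _
  refine mul_left_cancel₀ (show (a.factorial * b.factorial : ℝ) ≠ 0 by positivity) ?_
  rw [hl, hr, signedSum_reindex]
  refine signedSum_congr (fun w => ?_) v
  congr 2
  · funext i
    exact congrArg w (Fin.ext (by simp; ring))

/-- The differentiated slot has to move past the `a` arguments of `f`; the cycle doing so has sign
`(-1) ^ a`. -/
lemma alternatizeUncurryFin_altWedge_right {a b : ℕ} (f : E [⋀^Fin a]→L[ℝ] ℝ)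
    (L : E →L[ℝ] E [⋀^Fin b]→L[ℝ] ℝ) (L' : E →L[ℝ] E [⋀^Fin (a + b)]→L[ℝ] ℝ)
    (hL' : ∀ x, L' x = altWedge f (L x)) (v : Fin (a + b + 1) → E) :
    ContinuousAlternatingMap.alternatizeUncurryFin L' v =
      (-1) ^ a * altWedge f (ContinuousAlternatingMap.alternatizeUncurryFin L) v := by
  have hl : (a.factorial * b.factorial : ℝ) * ContinuousAlternatingMap.alternatizeUncurryFin L' v =
      signedSum (fun u : Fin (a + b + 1) → E => f (fun i => u (Fin.castAdd b i).succ) *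
        L (u 0) (fun i => u (Fin.natAdd a i).succ)) v := by
    refine mul_left_cancel₀ (show ((a + b).factorial : ℝ) ≠ 0 by positivity) ?_
    rw [mul_left_comm, ← signedSum_eq_alternatizeUncurryFin, ← signedSum_const_mul]
    refine Eq.trans (signedSum_congr (fun w => ?_) v) (signedSum_signedSum_succ (fun x y =>
      f (fun i => y (Fin.castAdd b i)) * L x (fun i => y (Fin.natAdd a i))) v)
    rw [hL', factorial_mul_altWedge]
  have hr : (a.factorial * b.factorial : ℝ) * altWedge f
      (ContinuousAlternatingMap.alternatizeUncurryFin L) v =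
      signedSum (fun u : Fin (a + (b + 1)) → E => f (fun i => u (Fin.castAdd (b + 1) i)) *
        L (u (Fin.natAdd a 0)) (fun i => u (Fin.natAdd a i.succ))) v := by
    refine mul_left_cancel₀ (show ((b + 1).factorial : ℝ) ≠ 0 by positivity) ?_
    have h1 := signedSum_signedSum_inr (fun (x : Fin a → E) (y : Fin (b + 1) → E) =>
      f x * L (y 0) (fun i => y i.succ)) ((show Fin (a + (b + 1)) → E from v) ∘ finSumFinEquiv)
    rw [Fintype.card_fin, signedSum_reindex finSumFinEquiv, signedSum_reindex finSumFinEquiv] at h1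
    refine Eq.trans ?_ h1
    rw [show ((b + 1).factorial * (a.factorial * b.factorial * altWedge f
      (ContinuousAlternatingMap.alternatizeUncurryFin L) v) : ℝ) = b.factorial * (a.factorial *
        (b + 1).factorial * altWedge f (ContinuousAlternatingMap.alternatizeUncurryFin L) v)
        by ring, factorial_mul_altWedge, ← signedSum_const_mul]
    refine signedSum_congr (fun w => ?_) _
    rw [mul_left_comm, ← signedSum_eq_alternatizeUncurryFin, ← signedSum_const_mul]
    rfl
  refine mul_left_cancel₀ (show (a.factorial * b.factorial : ℝ) ≠ 0 by positivity) ?_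
  rw [hl, mul_left_comm, hr]
  -- The cycle `c.cycleRange` shifts positions `0, …, a - 1` up by one, sends `a` to `0` and fixes
  -- the later positions.
  let c : Fin (a + b + 1) := ⟨a, by omega⟩
  have h3 := signedSum_comp_perm c.cycleRange
    (fun u : Fin (a + b + 1) → E => f (fun i => u (Fin.castAdd (b + 1) i)) *
        L (u (Fin.natAdd a (0 : Fin (b + 1)))) (fun i => u (Fin.natAdd a i.succ))) v
  rw [Fin.sign_cycleRange] at h3
  push_cast at h3
  refine Eq.trans (signedSum_congr (fun w => ?_) v) h3
  have e1 : ∀ i : Fin a, c.cycleRange (Fin.castAdd (b + 1) i) = (Fin.castAdd b i).succ := fun i => by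
    apply Fin.ext
    rw [Fin.coe_cycleRange_of_lt (by simp [Fin.lt_def, c])]
    simp
  have e2 : c.cycleRange (Fin.natAdd a (0 : Fin (b + 1))) = 0 :=
    Fin.cycleRange_self c
  have e3 : ∀ i : Fin b, c.cycleRange (Fin.natAdd a i.succ) = (Fin.natAdd a i).succ := fun i => by
    rw [Fin.cycleRange_of_gt (by simp [Fin.lt_def, c])]
    rfl
  simp only [Function.comp_apply, e1, e2, e3]

end WedgeUncurry

/-! ### Tensor products and separating families of functionals -/

section TensorSeparation

/-- Separating families of functionals on two vector spaces induce a separating family on their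
tensor product. -/
lemma tensor_eq_zero_of_separating {ι κ U W : Type*} [AddCommGroup U] [Module ℝ U]
    [AddCommGroup W] [Module ℝ W] (f : ι → U →ₗ[ℝ] ℝ) (g : κ → W →ₗ[ℝ] ℝ)
    (hf : ∀ u, (∀ i, f i u = 0) → u = 0) (hg : ∀ w, (∀ j, g j w = 0) → w = 0) (x : U ⊗[ℝ] W)
    (hx : ∀ i j, LinearMap.mul' ℝ ℝ (TensorProduct.map (f i) (g j) x) = 0) : x = 0 := by
  classical
  let b := Module.Basis.ofVectorSpace ℝ U
  let Φ := TensorProduct.equivFinsuppOfBasisLeft (N := W) b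
  suffices h : ∀ j m, g j (Φ x m) = 0 by
    apply Φ.injective
    rw [map_zero]
    ext m
    exact hg _ fun j => h j m
  intro j m
  -- Expand the tensor along a basis of the left factor. Contracting the right factor with `g j`
  -- gives the vector of `U` with coordinates `g j (Φ y m)`. The `f i` show that for `x` this vector
  -- is zero, and then the `g j` kill each coefficient.
  have h1 : ∀ y : U ⊗[ℝ] W, TensorProduct.rid ℝ U (TensorProduct.map LinearMap.id (g j) y) =
      b.repr.symm (Finsupp.mapRange.linearMap (g j) (Φ y)) := fun y => by
    induction y with
    | zero => simp
    | add y z hy hz => simp only [map_add, hy, hz]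
    | tmul u w =>
      apply b.repr.injective
      ext m
      simp [Φ, mul_comm]
  have h2 : TensorProduct.rid ℝ U (TensorProduct.map LinearMap.id (g j) x) = 0 := by
    refine hf _ fun i => ?_
    rw [← hx i j]
    generalize x = y
    induction y with
    | zero => simp
    | add y z hy hz => simp only [map_add, hy, hz]
    | tmul u w => simp [mul_comm]
  rw [h1, LinearEquiv.map_eq_zero_iff] at h2
  simpa using DFunLike.congr_fun h2 m

/-- A bilinear form that vanishes on `J s × J' t` for `s + t = r + 1` is a sum of products of
functionals vanishing on `J (s + 1)` and on `J' (t + 1)`, for `s + t = r`. -/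
lemma exists_tensor_of_filtered_bilinear {A A' U U' X Y : Type*} [AddCommGroup A] [Module ℝ A]
    [AddCommGroup A'] [Module ℝ A'] [AddCommGroup U] [Module ℝ U] [AddCommGroup U'] [Module ℝ U']
    [AddCommGroup X] [Module ℝ X] [AddCommGroup Y] [Module ℝ Y]
    (e : U →ₗ[ℝ] A →ₗ[ℝ] ℝ) (e' : U' →ₗ[ℝ] A' →ₗ[ℝ] ℝ) (i : U →ₗ[ℝ] X) (i' : U' →ₗ[ℝ] Y)
    (F : ℕ → Submodule ℝ U) (F' : ℕ → Submodule ℝ U')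
    (J : ℕ → Submodule ℝ A) (J' : ℕ → Submodule ℝ A') (hJ0 : J 0 = ⊤) (hJ : Antitone J)
    (hfin : ∀ s, FiniteDimensional ℝ (A ⧸ J s))
    (hF : ∀ s (l : A →ₗ[ℝ] ℝ), (∀ α ∈ J (s + 1), l α = 0) → ∃ u ∈ F s, e u = l)
    (hF' : ∀ s (l : A' →ₗ[ℝ] ℝ), (∀ α ∈ J' (s + 1), l α = 0) → ∃ u ∈ F' s, e' u = l)
    (B : A →ₗ[ℝ] A' →ₗ[ℝ] ℝ) (r : ℕ) (hB0 : ∀ α ∈ J (r + 1), B α = 0)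
    (hB : ∀ s t, s + t = r + 1 → ∀ α ∈ J s, ∀ β ∈ J' t, B α β = 0) :
    ∃ x : U ⊗[ℝ] U', (∀ α β, LinearMap.mul' ℝ ℝ (TensorProduct.map (e.flip α) (e'.flip β) x) =
        B α β) ∧
      TensorProduct.map i i' x ∈ ⨆ st ∈ Finset.HasAntidiagonal.antidiagonal r,
        LinearMap.range (TensorProduct.map (i ∘ₗ (F st.1).subtype) (i' ∘ₗ (F' st.2).subtype)) := by
  -- A linear section of the quotient map provides a projection `P s` with kernel `J s`.
  have hP : ∀ s, ∃ P : A →ₗ[ℝ] A, (∀ α ∈ J s, P α = 0) ∧ ∀ α, α - P α ∈ J s := fun s => by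
    obtain ⟨g, hg⟩ := (J s).mkQ.exists_rightInverse_of_surjective (J s).range_mkQ
    refine ⟨g ∘ₗ (J s).mkQ, fun α hα => ?_, fun α => ?_⟩
    · simp [(Submodule.Quotient.mk_eq_zero _).2 hα]
    · rw [← Submodule.Quotient.mk_eq_zero, Submodule.Quotient.mk_sub, sub_eq_zero]
      exact (LinearMap.congr_fun hg ((J s).mkQ α)).symm
  choose P hPz hPs using hP
  -- The difference `P (s + 1) - P s` takes values in `J s` and kills `J (s + 1)`. It therefore
  -- factors through the finite-dimensional `A ⧸ J (s + 1)`, whose coordinate functionals give the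
  -- left factors `u m`. The right factors `w m` are `B` evaluated at elements of `J s`, so they
  -- kill `J' (r - s + 1)`.
  have hpiece : ∀ s ∈ Finset.range (r + 1), ∃ x : U ⊗[ℝ] U', (∀ α β, LinearMap.mul' ℝ ℝ
      (TensorProduct.map (e.flip α) (e'.flip β) x) = B (P (s + 1) α - P s α) β) ∧
      TensorProduct.map i i' x ∈ LinearMap.range (TensorProduct.map (i ∘ₗ (F s).subtype)
        (i' ∘ₗ (F' (r - s)).subtype)) := fun s hs => by
    have hsr : s + (r - s + 1) = r + 1 := by have := Finset.mem_range.1 hs; omega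
    let b := Module.finBasis ℝ (A ⧸ J (s + 1))
    have hu := fun m => hF s (b.coord m ∘ₗ (J (s + 1)).mkQ) fun α hα => by
      simp [(Submodule.Quotient.mk_eq_zero _).2 hα]
    choose u huF hue using hu
    choose c hc using fun m => (J (s + 1)).mkQ_surjective (b m)
    have hQ : ∀ α, P (s + 1) α - P s α ∈ J s := fun α => by
      have := (J s).sub_mem (hPs s α) (hJ (Nat.le_succ s) (hPs (s + 1) α))
      simpa using this
    have hw := fun m => hF' (r - s) (B (P (s + 1) (c m) - P s (c m))) fun β hβ =>
      hB s (r - s + 1) hsr _ (hQ _) β hβ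
    choose w hwF hwe using hw
    refine ⟨∑ m, u m ⊗ₜ w m, fun α β => ?_, ?_⟩
    · have h1 : α - ∑ m, b.coord m ((J (s + 1)).mkQ α) • c m ∈ J (s + 1) := by
        rw [← Submodule.Quotient.mk_eq_zero, ← Submodule.mkQ_apply, map_sub, sub_eq_zero, map_sum]
        simp only [map_smul, hc]
        exact (b.sum_repr _).symm
      have h2 : P (s + 1) (α - ∑ m, b.coord m ((J (s + 1)).mkQ α) • c m) -
          P s (α - ∑ m, b.coord m ((J (s + 1)).mkQ α) • c m) = 0 := by
        rw [hPz _ _ h1, hPz _ _ (hJ (Nat.le_succ s) h1), sub_zero]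
      have h3 : P (s + 1) α - P s α = ∑ m, b.coord m ((J (s + 1)).mkQ α) •
          (P (s + 1) (c m) - P s (c m)) := by
        simp only [map_sub, map_sum, map_smul] at h2
        simp only [smul_sub, Finset.sum_sub_distrib]
        rw [← sub_eq_zero, ← h2]
        abel
      rw [h3]
      simp only [map_sum, map_smul, LinearMap.sum_apply, LinearMap.smul_apply,
        TensorProduct.map_tmul, LinearMap.flip_apply, LinearMap.mul'_apply, hue, hwe, smul_eq_mul]
      rfl
    · rw [map_sum]
      refine Submodule.sum_mem _ fun m _ => ⟨(⟨u m, huF m⟩ : F s) ⊗ₜ (⟨w m, hwF m⟩ : F' (r - s)), ?_⟩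
      simp
  choose! x hx hxm using hpiece
  refine ⟨∑ s ∈ Finset.range (r + 1), x s, fun α β => ?_, ?_⟩
  -- The pieces telescope to `P (r + 1) - P 0`. Here `P 0 = 0` because `J 0` is everything, and `B`
  -- does not see the error `α - P (r + 1) α`, which lies in `J (r + 1)`.
  · simp only [map_sum]
    rw [Finset.sum_congr rfl fun s hs => hx s hs α β, ← LinearMap.sum_apply, ← map_sum,
      Finset.sum_range_sub (fun s => P s α), hPz 0 α (by rw [hJ0]; trivial), sub_zero]
    have := hB0 _ (hPs (r + 1) α)
    rw [map_sub, sub_eq_zero] at this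
    rw [this]
  · rw [map_sum]
    refine Submodule.sum_mem _ fun s hs => ?_
    refine Submodule.mem_iSup_of_mem (s, r - s) (Submodule.mem_iSup_of_mem ?_ (hxm s hs))
    have := Finset.mem_range.1 hs
    simp; omega

end TensorSeparation

/-! ### The filtered differential graded coalgebra dual to a filtered algebra -/

section GradedDual

variable {A U : ℕ → Type*} [∀ k, AddCommGroup (A k)] [∀ k, Module ℝ (A k)]
  [∀ k, AddCommGroup (U k)] [∀ k, Module ℝ (U k)]

/-- Evaluation of `⨁ k, U k` on an element of `A k`, through the component of degree `k`. -/
def totalPairing (e : ∀ k, U k →ₗ[ℝ] A k →ₗ[ℝ] ℝ) {k : ℕ} (α : A k) : (⨁ k, U k) →ₗ[ℝ] ℝ :=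
  (e k).flip α ∘ₗ DirectSum.component ℝ ℕ U k

/-- Evaluation of the tensor square of `⨁ k, U k` on a pair of homogeneous elements. -/
def tensorPairing (e : ∀ k, U k →ₗ[ℝ] A k →ₗ[ℝ] ℝ) {a b : ℕ} (α : A a) (β : A b) :
    (⨁ k, U k) ⊗[ℝ] (⨁ k, U k) →ₗ[ℝ] ℝ :=
  LinearMap.mul' ℝ ℝ ∘ₗ TensorProduct.map (totalPairing e α) (totalPairing e β)

variable (e : ∀ k, U k →ₗ[ℝ] A k →ₗ[ℝ] ℝ)

lemma totalPairing_lof {k : ℕ} (α : A k) (T : U k) :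
    totalPairing e α (DirectSum.lof ℝ ℕ U k T) = e k T α := by
  simp [totalPairing, DirectSum.component.lof_self]

lemma totalPairing_lof_of_ne {k l : ℕ} (h : l ≠ k) (α : A k) (T : U l) :
    totalPairing e α (DirectSum.lof ℝ ℕ U l T) = 0 := by
  simp [totalPairing, DirectSum.component.of, h]

lemma eq_zero_of_totalPairing (he : ∀ k, Function.Injective (e k)) (T : ⨁ k, U k)
    (h : ∀ i : Σ k, A k, totalPairing e i.2 T = 0) : T = 0 := by
  refine DirectSum.ext_component ℝ fun k => he k ?_
  ext α
  simpa [totalPairing] using h ⟨k, α⟩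

/-- A graded algebra `A` (with unit `one`, product `mul` and differential `d`) with a decreasing
filtration `J` by subspaces of finite codimension, in duality with graded vector spaces `U k`
filtered by the annihilators `F k r` of `J k (r + 1)`. The algebra axioms are only required after
evaluation on `⨁ k, U k`. -/
structure FilteredDuality (A U : ℕ → Type*) [∀ k, AddCommGroup (A k)] [∀ k, Module ℝ (A k)]
    [∀ k, AddCommGroup (U k)] [∀ k, Module ℝ (U k)] (F : ∀ k, ℕ → Submodule ℝ (U k)) where
  pair : ∀ k, U k →ₗ[ℝ] A k →ₗ[ℝ] ℝ
  pair_injective : ∀ k, Function.Injective (pair k)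
  one : A 0
  mul : ∀ a b, A a →ₗ[ℝ] A b →ₗ[ℝ] A (a + b)
  d : ∀ k, A k →ₗ[ℝ] A (k + 1)
  J : ∀ k, ℕ → Submodule ℝ (A k)
  J_zero : ∀ k, J k 0 = ⊤
  J_antitone : ∀ k, Antitone (J k)
  J_finite : ∀ k s, FiniteDimensional ℝ (A k ⧸ J k s)
  mul_mem : ∀ {a b s t} {α : A a} {β : A b}, α ∈ J a s → β ∈ J b t → mul a b α β ∈ J (a + b) (s + t)
  d_mem : ∀ {k s} {α : A k}, α ∈ J k (s + 1) → d k α ∈ J (k + 1) s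
  mem_iff : ∀ k r (T : U k), T ∈ F k r ↔ ∀ α ∈ J k (r + 1), pair k T α = 0
  exhaustive : ∀ k (T : U k), ∃ r, T ∈ F k r
  exists_pair : ∀ k r (l : A k →ₗ[ℝ] ℝ), (∀ α ∈ J k (r + 1), l α = 0) → ∃ T, pair k T = l
  mul_assoc : ∀ {a b c} (α : A a) (β : A b) (γ : A c),
    totalPairing pair (mul _ _ (mul _ _ α β) γ) = totalPairing pair (mul _ _ α (mul _ _ β γ))
  one_mul : ∀ {b} (β : A b), totalPairing pair (mul _ _ one β) = totalPairing pair β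
  mul_one : ∀ {b} (β : A b), totalPairing pair (mul _ _ β one) = totalPairing pair β
  leibniz : ∀ {a b} (α : A a) (β : A b), totalPairing pair (d _ (mul _ _ α β)) =
    totalPairing pair (mul _ _ (d _ α) β) + (-1 : ℝ) ^ a • totalPairing pair (mul _ _ α (d _ β))
  d_d : ∀ {k} (α : A k), d _ (d _ α) = 0
  d_one : d _ one = 0

namespace FilteredDuality

variable {F : ∀ k, ℕ → Submodule ℝ (U k)} (D : FilteredDuality A U F)

lemma exists_mem_pair (k r : ℕ) (l : A k →ₗ[ℝ] ℝ) (h : ∀ α ∈ D.J k (r + 1), l α = 0) :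
    ∃ T ∈ F k r, D.pair k T = l := by
  obtain ⟨T, hT⟩ := D.exists_pair k r l h
  exact ⟨T, (D.mem_iff k r T).2 fun α hα => by rw [hT, h α hα], hT⟩

lemma monotone (D : FilteredDuality A U F) (k : ℕ) : Monotone (F k) := fun r s hrs T hT =>
  (D.mem_iff k s T).2 fun α hα =>
    (D.mem_iff k r T).1 hT α (D.J_antitone k (Nat.succ_le_succ hrs) hα)

lemma eq_zero_of_tensorPairing (x : (⨁ k, U k) ⊗[ℝ] (⨁ k, U k))
    (h : ∀ (a b : ℕ) (α : A a) (β : A b), tensorPairing D.pair α β x = 0) : x = 0 :=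
  tensor_eq_zero_of_separating (fun i : Σ k, A k => totalPairing D.pair i.2)
    (fun i : Σ k, A k => totalPairing D.pair i.2) (eq_zero_of_totalPairing _ D.pair_injective)
    (eq_zero_of_totalPairing _ D.pair_injective) x fun i j => h i.1 j.1 i.2 j.2

/-- In each bidegree `(a, b)` with `a + b = l`, multiplicativity of the filtration `J` gives the
vanishing required by `exists_tensor_of_filtered_bilinear`. The sum of the resulting tensors works
because distinct bidegrees do not interact under the pairings. -/
lemma exists_comul_lof (l r : ℕ) (T : U l) (hT : T ∈ F l r) :
    ∃ x ∈ tensorFiltration F l r, ∀ (a b : ℕ) (α : A a) (β : A b),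
      tensorPairing D.pair α β x =
        totalPairing D.pair (D.mul a b α β) (DirectSum.lof ℝ ℕ U l T) := by
  have hab : ∀ ab ∈ Finset.HasAntidiagonal.antidiagonal l, ∃ x : U ab.1 ⊗[ℝ] U ab.2,
      (∀ α β, LinearMap.mul' ℝ ℝ (TensorProduct.map ((D.pair ab.1).flip α) ((D.pair ab.2).flip β) x)
        = totalPairing D.pair (D.mul ab.1 ab.2 α β) (DirectSum.lof ℝ ℕ U l T)) ∧
      TensorProduct.map (DirectSum.lof ℝ ℕ U ab.1) (DirectSum.lof ℝ ℕ U ab.2) x ∈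
      ⨆ st ∈ Finset.HasAntidiagonal.antidiagonal r, LinearMap.range (TensorProduct.map
        (DirectSum.lof ℝ ℕ U ab.1 ∘ₗ (F ab.1 st.1).subtype)
        (DirectSum.lof ℝ ℕ U ab.2 ∘ₗ (F ab.2 st.2).subtype)) := by
    rintro ⟨a, b⟩ hab
    obtain rfl : a + b = l := Finset.HasAntidiagonal.mem_antidiagonal.1 hab
    have hB : ∀ s t, s + t = r + 1 → ∀ α ∈ D.J a s, ∀ β ∈ D.J b t,
        D.pair (a + b) T (D.mul a b α β) = 0 := fun s t hst α hα β hβ =>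
      (D.mem_iff _ _ _).1 hT _ (hst ▸ D.mul_mem hα hβ)
    obtain ⟨x, hx, hx'⟩ := exists_tensor_of_filtered_bilinear (D.pair a) (D.pair b)
      (DirectSum.lof ℝ ℕ U a) (DirectSum.lof ℝ ℕ U b) (F a) (F b) (D.J a) (D.J b) (D.J_zero a)
      (D.J_antitone a) (D.J_finite a) (D.exists_mem_pair a) (D.exists_mem_pair b)
      ((D.mul a b).compr₂ (D.pair (a + b) T)) r
      (fun α hα => LinearMap.ext fun β => hB (r + 1) 0 rfl α hα β (by rw [D.J_zero]; trivial)) hB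
    refine ⟨x, fun α β => ?_, hx'⟩
    rw [hx, totalPairing_lof]
    rfl
  choose! x hx hxm using hab
  refine ⟨∑ ab ∈ Finset.HasAntidiagonal.antidiagonal l, TensorProduct.map
    (DirectSum.lof ℝ ℕ U ab.1) (DirectSum.lof ℝ ℕ U ab.2) (x ab), ?_, fun a b α β => ?_⟩
  · exact Submodule.sum_mem _ fun ab hab =>
      Submodule.mem_iSup_of_mem ab (Submodule.mem_iSup_of_mem hab (hxm ab hab))
  · have hmap : ∀ ab : ℕ × ℕ, tensorPairing D.pair α β (TensorProduct.map
        (DirectSum.lof ℝ ℕ U ab.1) (DirectSum.lof ℝ ℕ U ab.2) (x ab)) = LinearMap.mul' ℝ ℝ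
        (TensorProduct.map (totalPairing D.pair α ∘ₗ DirectSum.lof ℝ ℕ U ab.1)
          (totalPairing D.pair β ∘ₗ DirectSum.lof ℝ ℕ U ab.2) (x ab)) := fun ab => by
      rw [TensorProduct.map_comp]; rfl
    have hself : ∀ {k : ℕ} (γ : A k), totalPairing D.pair γ ∘ₗ DirectSum.lof ℝ ℕ U k =
        (D.pair k).flip γ := fun γ => LinearMap.ext fun S => totalPairing_lof _ γ S
    have hne : ∀ {k l : ℕ} (_ : l ≠ k) (γ : A k), totalPairing D.pair γ ∘ₗ
        DirectSum.lof ℝ ℕ U l = 0 := fun h γ => LinearMap.ext fun S => totalPairing_lof_of_ne _ h γ S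
    rw [map_sum]
    simp only [hmap]
    by_cases hl : a + b = l
    · rw [Finset.sum_eq_single (a, b)]
      · rw [hself, hself]
        exact hx (a, b) (Finset.HasAntidiagonal.mem_antidiagonal.2 hl) α β
      · rintro ⟨a', b'⟩ hab' hne'
        by_cases ha : a' = a
        · have hb : b' ≠ b := fun h => hne' (by rw [ha, h])
          rw [hne hb, TensorProduct.map_zero_right]
          simp
        · rw [hne ha, TensorProduct.map_zero_left]
          simp
      · exact fun h => absurd (Finset.HasAntidiagonal.mem_antidiagonal.2 hl) h
    · rw [totalPairing_lof_of_ne _ (Ne.symm hl)]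
      refine Finset.sum_eq_zero ?_
      rintro ⟨a', b'⟩ hab'
      have hab' : a' + b' = l := Finset.HasAntidiagonal.mem_antidiagonal.1 hab'
      by_cases ha : a' = a
      · have hb : b' ≠ b := fun h => hl (by rw [← ha, ← h, hab'])
        rw [hne hb, TensorProduct.map_zero_right]
        simp
      · rw [hne ha, TensorProduct.map_zero_left]
        simp

/-- All evaluations of the tensor square, as one linear map. -/
def tensorPairings : (⨁ k, U k) ⊗[ℝ] (⨁ k, U k) →ₗ[ℝ] (Σ a, A a) × (Σ b, A b) → ℝ :=
  LinearMap.pi fun i => tensorPairing D.pair i.1.2 i.2.2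

lemma tensorPairings_injective : Function.Injective D.tensorPairings := by
  rw [injective_iff_map_eq_zero]
  exact fun x hx => D.eq_zero_of_tensorPairing x fun a b α β =>
    congrFun hx (⟨a, α⟩, ⟨b, β⟩)

/-- The transpose of the product, as a map to functions of pairs. -/
def mulTranspose : (⨁ k, U k) →ₗ[ℝ] (Σ a, A a) × (Σ b, A b) → ℝ :=
  LinearMap.pi fun i => totalPairing D.pair (D.mul _ _ i.1.2 i.2.2)

/-- Existence of a coproduct for each element separately suffices: since `tensorPairings` is
injective, inverting it on its range gives a linear map without compatible choices. -/
lemma mulTranspose_mem (T : ⨁ k, U k) :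
    D.mulTranspose T ∈ LinearMap.range D.tensorPairings := by
  induction T using DirectSum.induction_on with
  | zero => simp
  | add S T hS hT => rw [map_add]; exact Submodule.add_mem _ hS hT
  | of l T =>
    obtain ⟨r, hr⟩ := D.exhaustive l T
    obtain ⟨x, -, hx⟩ := D.exists_comul_lof l r T hr
    exact ⟨x, funext fun i => hx _ _ i.1.2 i.2.2⟩

/-- The coproduct dual to the product. -/
def comul : (⨁ k, U k) →ₗ[ℝ] (⨁ k, U k) ⊗[ℝ] (⨁ k, U k) :=
  (LinearEquiv.ofInjective D.tensorPairings D.tensorPairings_injective).symm.toLinearMap ∘ₗ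
    D.mulTranspose.codRestrict _ D.mulTranspose_mem

lemma tensorPairing_comul {a b : ℕ} (α : A a) (β : A b) (T : ⨁ k, U k) :
    tensorPairing D.pair α β (D.comul T) = totalPairing D.pair (D.mul a b α β) T := by
  have h : D.tensorPairings (D.comul T) = D.mulTranspose T := congrArg Subtype.val
    ((LinearEquiv.ofInjective D.tensorPairings D.tensorPairings_injective).apply_symm_apply
      (D.mulTranspose.codRestrict _ D.mulTranspose_mem T))
  exact congrFun h (⟨a, α⟩, ⟨b, β⟩)

/-- By uniqueness the coproduct equals the tensor constructed in the required filtration step. -/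
lemma comul_mem (l r : ℕ) (T : U l) (hT : T ∈ F l r) :
    D.comul (DirectSum.lof ℝ ℕ U l T) ∈ tensorFiltration F l r := by
  obtain ⟨x, hxm, hx⟩ := D.exists_comul_lof l r T hT
  have : D.comul (DirectSum.lof ℝ ℕ U l T) = x := by
    rw [← sub_eq_zero]
    refine D.eq_zero_of_tensorPairing _ fun a b α β => ?_
    rw [map_sub, tensorPairing_comul, hx, sub_self]
  rwa [this]

/-- If `T` kills `J (k + 1) (r + 1)`, then `T ∘ d` kills `J k (r + 2)`, hence is represented by an
element of `U k`. -/
lemma dTranspose_mem (k : ℕ) (T : U (k + 1)) :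
    ((D.pair (k + 1)).compl₂ (D.d k)) T ∈ LinearMap.range (D.pair k) := by
  obtain ⟨r, hr⟩ := D.exhaustive _ T
  exact D.exists_pair k (r + 1) _ fun α hα => (D.mem_iff _ _ _).1 hr _ (D.d_mem hα)

/-- The boundary dual to the differential. -/
def boundary (k : ℕ) : U (k + 1) →ₗ[ℝ] U k :=
  (LinearEquiv.ofInjective (D.pair k) (D.pair_injective k)).symm.toLinearMap ∘ₗ
    ((D.pair (k + 1)).compl₂ (D.d k)).codRestrict _ (D.dTranspose_mem k)

lemma pair_boundary (k : ℕ) (T : U (k + 1)) (α : A k) :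
    D.pair k (D.boundary k T) α = D.pair (k + 1) T (D.d k α) :=
  LinearMap.congr_fun (congrArg Subtype.val
    ((LinearEquiv.ofInjective (D.pair k) (D.pair_injective k)).apply_symm_apply
      (((D.pair (k + 1)).compl₂ (D.d k)).codRestrict _ (D.dTranspose_mem k) T))) α

lemma totalPairing_totalBoundary {k : ℕ} (α : A k) :
    totalPairing D.pair α ∘ₗ totalBoundary D.boundary = totalPairing D.pair (D.d k α) := by
  refine DirectSum.linearMap_ext ℝ fun l => LinearMap.ext fun T => ?_
  simp only [LinearMap.comp_apply, totalBoundary, DirectSum.toModule_lof]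
  cases l with
  | zero => rw [totalPairing_lof_of_ne _ (Nat.succ_ne_zero k).symm]; simp
  | succ l =>
    simp only [LinearMap.comp_apply]
    by_cases h : l = k
    · subst h
      rw [totalPairing_lof, totalPairing_lof, pair_boundary]
    · rw [totalPairing_lof_of_ne _ h, totalPairing_lof_of_ne _ (by omega)]

lemma totalPairing_gradingSign {k : ℕ} (α : A k) :
    totalPairing D.pair α ∘ₗ gradingSign U = (-1 : ℝ) ^ k • totalPairing D.pair α := by
  refine DirectSum.linearMap_ext ℝ fun l => LinearMap.ext fun T => ?_
  simp only [LinearMap.comp_apply, gradingSign, DirectSum.toModule_lof, LinearMap.smul_apply,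
    map_smul]
  by_cases h : l = k
  · subst h; rfl
  · simp [totalPairing_lof_of_ne _ h]

lemma tensorPairing_map {a b a' b' : ℕ} {f g : (⨁ k, U k) →ₗ[ℝ] ⨁ k, U k} {α : A a} {β : A b}
    {α' : A a'} {β' : A b'} {c : ℝ}
    (hf : totalPairing D.pair α ∘ₗ f = c • totalPairing D.pair α')
    (hg : totalPairing D.pair β ∘ₗ g = totalPairing D.pair β') (x : (⨁ k, U k) ⊗[ℝ] (⨁ k, U k)) :
    tensorPairing D.pair α β (TensorProduct.map f g x) = c * tensorPairing D.pair α' β' x := by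
  have h : tensorPairing D.pair α β (TensorProduct.map f g x) = LinearMap.mul' ℝ ℝ
      (TensorProduct.map (totalPairing D.pair α ∘ₗ f) (totalPairing D.pair β ∘ₗ g) x) := by
    rw [TensorProduct.map_comp]; rfl
  rw [h, hf, hg, TensorProduct.map_smul_left,
    LinearMap.smul_apply, map_smul, smul_eq_mul]
  rfl

/-- This is the transpose of the Leibniz rule: pairing the sign operator with `α` of degree `a`
produces the factor `(-1) ^ a`. -/
lemma comul_boundary : D.comul ∘ₗ totalBoundary D.boundary =
    (TensorProduct.map (totalBoundary D.boundary) LinearMap.id +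
      TensorProduct.map (gradingSign U) (totalBoundary D.boundary)) ∘ₗ D.comul := by
  refine LinearMap.ext fun T => ?_
  rw [← sub_eq_zero]
  refine D.eq_zero_of_tensorPairing _ fun a b α β => ?_
  rw [map_sub, sub_eq_zero, LinearMap.comp_apply, LinearMap.comp_apply, tensorPairing_comul,
    ← LinearMap.comp_apply, totalPairing_totalBoundary, leibniz, LinearMap.add_apply,
    LinearMap.add_apply, map_add,
    D.tensorPairing_map (c := 1) (by rw [one_smul]; exact D.totalPairing_totalBoundary α)
      (LinearMap.comp_id _),
    D.tensorPairing_map (D.totalPairing_gradingSign α) (D.totalPairing_totalBoundary β),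
    tensorPairing_comul, tensorPairing_comul, _root_.one_mul]
  rfl

/-- The coalgebra structure dual to the algebra structure. -/
abbrev coalgebra : Coalgebra ℝ (⨁ k, U k) where
  comul := D.comul
  counit := totalPairing D.pair D.one
  coassoc := by
    refine LinearMap.ext fun T => ?_
    rw [← sub_eq_zero]
    have hs := eq_zero_of_totalPairing D.pair D.pair_injective
    -- Applying the separation principle again, with the tensor square as right factor, shows that
    -- triples of elements of the algebra separate the points of the triple tensor product.
    -- Co-associativity is then tested on such a triple, where it reads as associativity.
    refine tensor_eq_zero_of_separating (fun i : Σ k, A k => totalPairing D.pair i.2)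
      (fun i : (Σ k, A k) × (Σ k, A k) => tensorPairing D.pair i.1.2 i.2.2) hs
      (fun x hx => D.eq_zero_of_tensorPairing x fun a b α β => hx (⟨a, α⟩, ⟨b, β⟩)) _ ?_
    rintro ⟨a, α⟩ ⟨⟨b, β⟩, ⟨c, γ⟩⟩
    rw [map_sub, map_sub, sub_eq_zero]
    have h1 : ∀ x : (⨁ k, U k) ⊗[ℝ] (⨁ k, U k), LinearMap.mul' ℝ ℝ (TensorProduct.map
        (totalPairing D.pair α) (tensorPairing D.pair β γ)
        (TensorProduct.assoc ℝ _ _ _ (D.comul.rTensor _ x))) =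
        tensorPairing D.pair (D.mul _ _ α β) γ x := fun x => by
      have h2 : ∀ (y : (⨁ k, U k) ⊗[ℝ] (⨁ k, U k)) (S : ⨁ k, U k), LinearMap.mul' ℝ ℝ
          (TensorProduct.map (totalPairing D.pair α) (tensorPairing D.pair β γ)
          (TensorProduct.assoc ℝ _ _ _ (y ⊗ₜ S))) =
          tensorPairing D.pair α β y * totalPairing D.pair γ S := fun y S => by
        induction y with
        | zero => simp
        | add y z hy hz => simp only [TensorProduct.add_tmul, map_add, hy, hz, add_mul]
        | tmul u w => simp [tensorPairing, _root_.mul_assoc]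
      induction x with
      | zero => simp
      | add y z hy hz => simp only [map_add, hy, hz]
      | tmul u w =>
        rw [LinearMap.rTensor_tmul, h2, tensorPairing_comul]
        simp [tensorPairing]
    have h3 : ∀ x : (⨁ k, U k) ⊗[ℝ] (⨁ k, U k), LinearMap.mul' ℝ ℝ (TensorProduct.map
        (totalPairing D.pair α) (tensorPairing D.pair β γ) (D.comul.lTensor _ x)) =
        tensorPairing D.pair α (D.mul _ _ β γ) x := fun x => by
      induction x with
      | zero => simp
      | add y z hy hz => simp only [map_add, hy, hz]
      | tmul u w =>
        rw [LinearMap.lTensor_tmul, TensorProduct.map_tmul, tensorPairing_comul]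
        simp [tensorPairing]
    exact (h1 _).trans (((D.tensorPairing_comul _ _ _).trans (by rw [D.mul_assoc])).trans
      ((D.tensorPairing_comul _ _ _).symm.trans (h3 _).symm))
  rTensor_counit_comp_comul := by
    refine LinearMap.ext fun T => (TensorProduct.lid ℝ _).injective ?_
    rw [← sub_eq_zero]
    refine eq_zero_of_totalPairing D.pair D.pair_injective _ fun ⟨b, β⟩ => ?_
    have h : ∀ x : (⨁ k, U k) ⊗[ℝ] (⨁ k, U k), totalPairing D.pair β (TensorProduct.lid ℝ _
        ((totalPairing D.pair D.one).rTensor _ x)) = tensorPairing D.pair D.one β x := fun x => by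
      induction x with
      | zero => simp
      | add y z hy hz => simp only [map_add, hy, hz]
      | tmul u w => simp [tensorPairing]
    rw [map_sub, LinearMap.comp_apply, h, tensorPairing_comul, D.one_mul]
    simp
  lTensor_counit_comp_comul := by
    refine LinearMap.ext fun T => (TensorProduct.rid ℝ _).injective ?_
    rw [← sub_eq_zero]
    refine eq_zero_of_totalPairing D.pair D.pair_injective _ fun ⟨b, β⟩ => ?_
    have h : ∀ x : (⨁ k, U k) ⊗[ℝ] (⨁ k, U k), totalPairing D.pair β (TensorProduct.rid ℝ _
        ((totalPairing D.pair D.one).lTensor _ x)) = tensorPairing D.pair β D.one x := fun x => by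
      induction x with
      | zero => simp
      | add y z hy hz => simp only [map_add, hy, hz]
      | tmul u w => simp [tensorPairing, mul_comm]
    rw [map_sub, LinearMap.comp_apply, h, tensorPairing_comul, D.mul_one]
    simp

end FilteredDuality

end GradedDual

/-! ### Assembly of the dual filtered differential graded coalgebra -/

section GradedDualCoalgebra

universe u

variable {A : ℕ → Type*} {U : ℕ → Type u} [∀ k, AddCommGroup (A k)] [∀ k, Module ℝ (A k)]
  [∀ k, AddCommGroup (U k)] [∀ k, Module ℝ (U k)] {F : ∀ k, ℕ → Submodule ℝ (U k)}

/-- The filtered differential graded coalgebra dual to a filtered differential graded algebra. -/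
def FilteredDuality.filteredDGCoalgebra (D : FilteredDuality A U F) : FilteredDGCoalgebra U F where
  toCoalgebra := D.coalgebra
  boundary := D.boundary
  filtration_mono := D.monotone
  filtration_exhaustive := D.exhaustive
  comul_mem := D.comul_mem
  counit_lof_succ k x := totalPairing_lof_of_ne _ (Nat.succ_ne_zero k) _ _
  boundary_mem k r x hx := (D.mem_iff _ _ _).2 fun α hα => by
    rw [D.pair_boundary]
    exact (D.mem_iff _ _ _).1 hx _ (D.d_mem hα)
  boundary_boundary k x := D.pair_injective k <| LinearMap.ext fun α => by
    rw [D.pair_boundary, D.pair_boundary, D.d_d, map_zero, map_zero]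
    rfl
  counit_boundary x := (totalPairing_lof _ _ _).trans (by rw [D.pair_boundary, D.d_one, map_zero])
  comul_boundary := D.comul_boundary

end GradedDualCoalgebra

/-! ### The algebra of smooth differential forms -/

section FormAlgebra

variable {E : Type*} [NormedAddCommGroup E] [NormedSpace ℝ E]
  {M : Type*} [TopologicalSpace M] [ChartedSpace E M]

lemma mfderiv_chart_symm_comp_mfderiv_chart [IsManifold 𝓘(ℝ, E) ∞ M] (x : M) :
    (mfderiv 𝓘(ℝ, E) 𝓘(ℝ, E) (chartAt E x).symm (chartAt E x x) : E →L[ℝ] E).comp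
      (mfderiv 𝓘(ℝ, E) 𝓘(ℝ, E) (chartAt E x) x : E →L[ℝ] E) = ContinuousLinearMap.id ℝ E := by
  set φ := chartAt E x
  have hx : x ∈ φ.source := mem_chart_source E x
  have hne : (∞ : WithTop ℕ∞) ≠ 0 := by simp
  have h1 : MDifferentiableAt 𝓘(ℝ, E) 𝓘(ℝ, E) φ.symm (φ x) :=
    ((contMDiffOn_chart_symm (I := 𝓘(ℝ, E)) (n := ∞) (x := x)).contMDiffAt
      (φ.open_target.mem_nhds (φ.map_source hx))).mdifferentiableAt hne
  have h2 : MDifferentiableAt 𝓘(ℝ, E) 𝓘(ℝ, E) φ x :=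
    ((contMDiffOn_chart (I := 𝓘(ℝ, E)) (n := ∞) (x := x)).contMDiffAt
      (φ.open_source.mem_nhds hx)).mdifferentiableAt hne
  have h3 := mfderiv_comp x h1 h2
  have h4 : φ.symm ∘ φ =ᶠ[𝓝 x] id := by
    filter_upwards [φ.open_source.mem_nhds hx] with z hz using φ.left_inv hz
  rw [h4.mfderiv_eq, mfderiv_id] at h3
  exact h3.symm

/-- A form is determined by its coordinate expressions at the centers of the charts. -/
lemma rawForm_ext [IsManifold 𝓘(ℝ, E) ∞ M] {k : ℕ} {α β : RawForm E M k}
    (h : ∀ x, formInChart α x (chartAt E x x) = formInChart β x (chartAt E x x)) : α = β := by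
  funext x
  have hback : (chartAt E x).symm (chartAt E x x) = x :=
    (chartAt E x).left_inv (mem_chart_source E x)
  have key : ∀ G : M → E [⋀^Fin k]→L[ℝ] ℝ,
      ((G ((chartAt E x).symm (chartAt E x x))).compContinuousLinearMap
        (mfderiv 𝓘(ℝ, E) 𝓘(ℝ, E) (chartAt E x).symm (chartAt E x x) : E →L[ℝ] E)
        ).compContinuousLinearMap (mfderiv 𝓘(ℝ, E) 𝓘(ℝ, E) (chartAt E x) x : E →L[ℝ] E) = G x :=
    fun G => by
      rw [hback]
      ext v
      have := mfderiv_chart_symm_comp_mfderiv_chart (E := E) x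
      exact congrArg (G x) (funext fun i => DFunLike.congr_fun this (v i))
  refine (key α).symm.trans (Eq.trans ?_ (key β))
  exact congrArg (fun f : E [⋀^Fin k]→L[ℝ] ℝ => f.compContinuousLinearMap _) (h x)

lemma formInChart_wedge [FiniteDimensional ℝ E] {a b : ℕ} (α : DiffForm E M ∞ a)
    (β : DiffForm E M ∞ b) (x₀ : M) (y : E) :
    formInChart (α.wedge β).1 x₀ y = altWedge (formInChart α.1 x₀ y) (formInChart β.1 x₀ y) :=
  altWedge_comp _ _ _

namespace DiffForm

lemma contDiffAt_formInChart {r : WithTop ℕ∞} {k : ℕ} (α : DiffForm E M r k) (x₀ : M) {y : E}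
    (hy : y ∈ (chartAt E x₀).target) : ContDiffAt ℝ r (formInChart α.1 x₀) y :=
  (α.2 x₀).contDiffAt ((chartAt E x₀).open_target.mem_nhds hy)

lemma differentiableAt_formInChart {k : ℕ} (α : DiffForm E M ∞ k) (x₀ : M) {y : E}
    (hy : y ∈ (chartAt E x₀).target) : DifferentiableAt ℝ (formInChart α.1 x₀) y :=
  (α.contDiffAt_formInChart x₀ hy).differentiableAt (by simp)

lemma ext_formInChart [IsManifold 𝓘(ℝ, E) ∞ M] {r : WithTop ℕ∞} {k : ℕ} {α β : DiffForm E M r k}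
    (h : ∀ x, ∀ y ∈ (chartAt E x).target, formInChart α.1 x y = formInChart β.1 x y) : α = β :=
  Subtype.ext (rawForm_ext fun x => h x _ (mem_chart_target E x))

/-- Transport of a form along an equality of degrees. -/
def cast {k l : ℕ} (h : k = l) (α : DiffForm E M ∞ k) : DiffForm E M ∞ l := h ▸ α

lemma cast_apply {k l : ℕ} (h : k = l) (α : DiffForm E M ∞ k) (x : M)
    (v : Fin l → TangentSpace 𝓘(ℝ, E) x) : (α.cast h).1 x v = α.1 x (v ∘ finCongr h) := by
  subst h; rfl

lemma formInChart_cast_apply {k l : ℕ} (h : k = l) (α : DiffForm E M ∞ k) (x : M) (y : E)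
    (v : Fin l → E) : formInChart (α.cast h).1 x y v = formInChart α.1 x y (v ∘ finCongr h) := by
  subst h; rfl

/-- Evaluation does not see transport along equal degrees. For this reason `FilteredDuality` states
its degree-changing axioms after evaluation, where no casts occur. -/
lemma evalForm_cast {p : M} {k l : ℕ} (h : k = l) (α : DiffForm E M ∞ k) :
    evalForm p (α.cast h) = evalForm p α := by
  subst h; rfl

/-- The exterior derivative as a linear map. -/
def dₗ (E M : Type*) [NormedAddCommGroup E] [NormedSpace ℝ E] [TopologicalSpace M]
    [ChartedSpace E M] [IsManifold 𝓘(ℝ, E) ∞ M] (k : ℕ) :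
    DiffForm E M ∞ k →ₗ[ℝ] DiffForm E M ∞ (k + 1) where
  toFun := d
  map_add' α β := ext_formInChart fun x y hy => by
    refine (formInChart_extDerivForm (α + β) x hy).trans ?_
    change extDeriv (formInChart α.1 x + formInChart β.1 x) y =
      formInChart (extDerivForm α.1) x y + formInChart (extDerivForm β.1) x y
    rw [extDeriv_add (α.differentiableAt_formInChart x hy) (β.differentiableAt_formInChart x hy),
      formInChart_extDerivForm α x hy, formInChart_extDerivForm β x hy]
  map_smul' c α := ext_formInChart fun x y hy => by
    refine (formInChart_extDerivForm (c • α) x hy).trans ?_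
    change extDeriv (c • formInChart α.1 x) y = c • formInChart (extDerivForm α.1) x y
    rw [extDeriv_smul, formInChart_extDerivForm α x hy]

lemma d_d [IsManifold 𝓘(ℝ, E) ∞ M] {k : ℕ} (α : DiffForm E M ∞ k) : α.d.d = 0 :=
  ext_formInChart fun x y hy => by
    refine (formInChart_extDerivForm α.d x hy).trans ?_
    -- Agreement on a neighbourhood is needed, since the expression is differentiated once more.
    have h : formInChart α.d.1 x =ᶠ[𝓝 y] extDeriv (formInChart α.1 x) := by
      filter_upwards [(chartAt E x).open_target.mem_nhds hy] with z hz
      exact formInChart_extDerivForm α x hz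
    rw [h.extDeriv_eq, extDeriv_extDeriv_apply (α.contDiffAt_formInChart x hy)
      (by simpa using WithTop.coe_le_coe.2 (le_top : (2 : ℕ∞) ≤ ⊤))]
    rfl

lemma d_one [IsManifold 𝓘(ℝ, E) ∞ M] : (one : DiffForm E M ∞ 0).d = 0 :=
  ext_formInChart fun x y hy => by
    refine (formInChart_extDerivForm one x hy).trans ?_
    have h : formInChart (one : DiffForm E M ∞ 0).1 x = fun _ =>
      ContinuousAlternatingMap.constOfIsEmpty ℝ E (Fin 0) (1 : ℝ) := rfl
    rw [h]
    simp only [extDeriv, fderiv_fun_const]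
    ext v
    simp [ContinuousAlternatingMap.alternatizeUncurryFin_apply]
    rfl

variable [FiniteDimensional ℝ E]

/-- The wedge product as a bilinear map. -/
def wedgeₗ (E M : Type*) [NormedAddCommGroup E] [NormedSpace ℝ E] [TopologicalSpace M]
    [ChartedSpace E M] [FiniteDimensional ℝ E] (a b : ℕ) :
    DiffForm E M ∞ a →ₗ[ℝ] DiffForm E M ∞ b →ₗ[ℝ] DiffForm E M ∞ (a + b) :=
  LinearMap.mk₂ ℝ wedge
    (fun α β γ => Subtype.ext <| funext fun x => (altWedgeₗ E a b).map_add₂ (α.1 x) (β.1 x) (γ.1 x))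
    (fun c α β => Subtype.ext <| funext fun x => (altWedgeₗ E a b).map_smul₂ c (α.1 x) (β.1 x))
    (fun α β γ => Subtype.ext <| funext fun x => (altWedgeₗ E a b (α.1 x)).map_add (β.1 x) (γ.1 x))
    (fun c α β => Subtype.ext <| funext fun x => (altWedgeₗ E a b (α.1 x)).map_smul c (β.1 x))

lemma wedge_assoc {a b c : ℕ} (α : DiffForm E M ∞ a) (β : DiffForm E M ∞ b)
    (γ : DiffForm E M ∞ c) :
    ((α.wedge β).wedge γ).cast (add_assoc a b c) = α.wedge (β.wedge γ) :=
  Subtype.ext <| funext fun x => ContinuousAlternatingMap.ext fun v =>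
    (cast_apply _ _ x v).trans (altWedge_assoc (α.1 x) (β.1 x) (γ.1 x) v)

lemma one_wedge {b : ℕ} (β : DiffForm E M ∞ b) : (one.wedge β).cast (zero_add b) = β :=
  Subtype.ext <| funext fun x => ContinuousAlternatingMap.ext fun v =>
    (cast_apply _ _ x v).trans (one_altWedge (β.1 x) v)

lemma wedge_one {b : ℕ} (β : DiffForm E M ∞ b) : β.wedge one = β :=
  Subtype.ext <| funext fun x => ContinuousAlternatingMap.ext fun v => altWedge_one (β.1 x) v

end DiffForm

section

variable [FiniteDimensional ℝ E]

/-- The wedge product as a continuous bilinear map. -/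
def altWedgeL (E : Type*) [NormedAddCommGroup E] [NormedSpace ℝ E] [FiniteDimensional ℝ E]
    (a b : ℕ) : (E [⋀^Fin a]→L[ℝ] ℝ) →L[ℝ] (E [⋀^Fin b]→L[ℝ] ℝ) →L[ℝ]
      (E [⋀^Fin (a + b)]→L[ℝ] ℝ) :=
  haveI := finiteDimensional_alternating (E := E) a
  haveI := finiteDimensional_alternating (E := E) b
  (altWedgeₗ E a b).toContinuousBilinearMap

lemma altWedgeL_apply {a b : ℕ} (f : E [⋀^Fin a]→L[ℝ] ℝ) (g : E [⋀^Fin b]→L[ℝ] ℝ) :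
    altWedgeL E a b f g = altWedge f g := by
  have := finiteDimensional_alternating (E := E) a
  have := finiteDimensional_alternating (E := E) b
  rw [altWedgeL, LinearMap.toContinuousBilinearMap_apply]
  rfl

/-- The product rule for the continuous bilinear map `altWedgeL` gives two terms, and
antisymmetrizing them brings in the sign `(-1) ^ a` only when the second factor is differentiated.
-/
lemma extDeriv_altWedge_apply {a b : ℕ} {f : E → E [⋀^Fin a]→L[ℝ] ℝ} {g : E → E [⋀^Fin b]→L[ℝ] ℝ}
    {y : E} (hf : DifferentiableAt ℝ f y) (hg : DifferentiableAt ℝ g y) (v : Fin (a + b + 1) → E) :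
    extDeriv (fun z => altWedge (f z) (g z)) y v =
      altWedge (extDeriv f y) (g y) (v ∘ finCongr (Nat.add_right_comm a 1 b)) +
        (-1) ^ a * altWedge (f y) (extDeriv g y) v := by
  have h := (altWedgeL E a b).hasFDerivAt_of_bilinear hf.hasFDerivAt hg.hasFDerivAt
  simp only [altWedgeL_apply] at h
  rw [extDeriv, h.fderiv, ContinuousAlternatingMap.alternatizeUncurryFin_add,
    ContinuousAlternatingMap.add_apply, add_comm,
    alternatizeUncurryFin_altWedge_left (fderiv ℝ f y) (g y) _ (fun x => by
      rw [← altWedgeL_apply]; rfl),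
    alternatizeUncurryFin_altWedge_right (f y) (fderiv ℝ g y) _ (fun x => by
      rw [← altWedgeL_apply]; rfl)]
  rfl

lemma DiffForm.d_wedge [IsManifold 𝓘(ℝ, E) ∞ M] {a b : ℕ} (α : DiffForm E M ∞ a)
    (β : DiffForm E M ∞ b) :
    (α.wedge β).d = (α.d.wedge β).cast (Nat.add_right_comm a 1 b) +
      (-1 : ℝ) ^ a • (show DiffForm E M ∞ (a + b + 1) from α.wedge β.d) :=
  ext_formInChart fun x y hy => by
    refine (formInChart_extDerivForm (α.wedge β) x hy).trans ?_
    rw [show formInChart (α.wedge β).1 x = fun z => altWedge (formInChart α.1 x z)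
      (formInChart β.1 x z) from funext fun z => formInChart_wedge α β x z]
    ext v
    rw [extDeriv_altWedge_apply (α.differentiableAt_formInChart x hy)
      (β.differentiableAt_formInChart x hy)]
    change _ = formInChart ((α.d.wedge β).cast (Nat.add_right_comm a 1 b)).1 x y v +
      (-1 : ℝ) ^ a * formInChart (α.wedge β.d).1 x y v
    rw [formInChart_cast_apply, formInChart_wedge, formInChart_wedge,
      ← formInChart_extDerivForm α x hy, ← formInChart_extDerivForm β x hy]
    rfl

end

end FormAlgebra

/-! ### Jets of forms at a point -/

section Jets

variable {E : Type*} [NormedAddCommGroup E] [NormedSpace ℝ E]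
  {M : Type*} [TopologicalSpace M] [ChartedSpace E M]

/-- The singleton `{y}` is one of the compact sets on which the topology controls derivatives. -/
lemma DiffForm.continuous_iteratedFDeriv_formInChart {r : WithTop ℕ∞} {k : ℕ} (x₀ : M) {j : ℕ}
    (hj : (j : WithTop ℕ∞) ≤ r) {y : E} (hy : y ∈ (chartAt E x₀).target) :
    Continuous fun α : DiffForm E M r k => iteratedFDeriv ℝ j (formInChart α.1 x₀) y := by
  have h : Continuous fun α : DiffForm E M r k =>
      UniformOnFun.ofFun {K : Set E | IsCompact K ∧ K ⊆ (chartAt E x₀).target}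
        (iteratedFDeriv ℝ j (formInChart α.1 x₀)) :=
    continuous_iff_le_induced.2 (iInf_le_of_le x₀ (iInf₂_le j hj))
  exact (UniformOnFun.uniformContinuous_eval_of_mem (β := E [×j]→L[ℝ] (E [⋀^Fin k]→L[ℝ] ℝ))
    (𝔖 := {K : Set E | IsCompact K ∧ K ⊆ (chartAt E x₀).target}) (s := {y}) rfl
    ⟨isCompact_singleton, Set.singleton_subset_iff.2 hy⟩).continuous.comp h

/-- The space of Taylor coefficients of order `< n` of `k`-forms on `E`. -/
def JetSpace (E : Type*) [NormedAddCommGroup E] [NormedSpace ℝ E] (k n : ℕ) : Type _ :=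
  (i : Fin n) → E [×(i : ℕ)]→L[ℝ] (E [⋀^Fin k]→L[ℝ] ℝ)

instance (k n : ℕ) : NormedAddCommGroup (JetSpace E k n) :=
  Pi.normedAddCommGroup (G := fun i : Fin n => E [×(i : ℕ)]→L[ℝ] (E [⋀^Fin k]→L[ℝ] ℝ))

instance (k n : ℕ) : NormedSpace ℝ (JetSpace E k n) :=
  Pi.normedSpace (E := fun i : Fin n => E [×(i : ℕ)]→L[ℝ] (E [⋀^Fin k]→L[ℝ] ℝ))

/-- The Taylor coefficients of order `< n` at `p`, in the preferred chart. -/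
def jetL {r : WithTop ℕ∞} (k n : ℕ) (hn : ∀ i < n, (i : WithTop ℕ∞) ≤ r) (p : M) :
    DiffForm E M r k →L[ℝ] JetSpace E k n where
  toFun α i := iteratedFDeriv ℝ i (formInChart α.1 p) (chartAt E p p)
  map_add' α β := funext fun i => iteratedFDeriv_add_apply
    ((α.contDiffAt_formInChart p (mem_chart_target E p)).of_le (hn i i.2))
    ((β.contDiffAt_formInChart p (mem_chart_target E p)).of_le (hn i i.2))
  map_smul' c α := funext fun i => iteratedFDeriv_const_smul_apply (a := c)
    ((α.contDiffAt_formInChart p (mem_chart_target E p)).of_le (hn i i.2))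
  cont := continuous_pi fun i =>
    DiffForm.continuous_iteratedFDeriv_formInChart p (hn i i.2) (mem_chart_target E p)

lemma natCast_le_infty (i : ℕ) : (i : WithTop ℕ∞) ≤ ∞ := by exact_mod_cast le_top

/-- The smooth forms whose Taylor coefficients of order `< s` at `p` vanish. -/
def vanishingForms (E : Type*) [NormedAddCommGroup E] [NormedSpace ℝ E] {M : Type*}
    [TopologicalSpace M] [ChartedSpace E M] (p : M) (k s : ℕ) : Submodule ℝ (DiffForm E M ∞ k) :=
  LinearMap.ker (jetL k s (fun i _ => natCast_le_infty i) p).toLinearMap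

lemma mem_vanishingForms {p : M} {k s : ℕ} {α : DiffForm E M ∞ k} :
    α ∈ vanishingForms E p k s ↔
      ∀ i < s, iteratedFDeriv ℝ i (formInChart α.1 p) (chartAt E p p) = 0 := by
  rw [vanishingForms, LinearMap.mem_ker]
  exact ⟨fun h i hi => congrFun h ⟨i, hi⟩, fun h => funext fun i => h i i.2⟩

lemma vanishingForms_zero (p : M) (k : ℕ) : vanishingForms E p k 0 = ⊤ :=
  (Submodule.eq_top_iff'.2 fun _ => mem_vanishingForms.2 fun i hi => absurd hi (Nat.not_lt_zero i))

lemma vanishingForms_antitone (p : M) (k : ℕ) : Antitone (vanishingForms E p k) :=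
  fun _ _ hst _ h => mem_vanishingForms.2 fun i hi => mem_vanishingForms.1 h i (hi.trans_le hst)

/-- This makes functionals on jets at `p` have support at `p`. -/
lemma mem_vanishingForms_of_eventually_eq_zero {p : M} {k : ℕ} {α : DiffForm E M ∞ k}
    (h : ∀ᶠ x in 𝓝 p, α.1 x = 0) (s : ℕ) : α ∈ vanishingForms E p k s := by
  refine mem_vanishingForms.2 fun i _ => ?_
  have h1 : formInChart α.1 p =ᶠ[𝓝 (chartAt E p p)] fun _ => 0 := by
    have hc := (chartAt E p).continuousAt_symm (mem_chart_target E p)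
    rw [ContinuousAt, (chartAt E p).left_inv (mem_chart_source E p)] at hc
    filter_upwards [hc.eventually h] with y hy
    simp only [formInChart, hy]
    rfl
  rw [(h1.iteratedFDeriv ℝ i).eq_of_nhds]
  simp

/-- In the chart, `d` is a fixed continuous linear map applied to the first derivative, so the
`i`-th derivative of `α.d` is governed by the derivative of order `i + 1` of `α`. -/
lemma d_mem_vanishingForms [IsManifold 𝓘(ℝ, E) ∞ M] {p : M} {k s : ℕ} {α : DiffForm E M ∞ k}
    (h : α ∈ vanishingForms E p k (s + 1)) : α.d ∈ vanishingForms E p (k + 1) s := by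
  refine mem_vanishingForms.2 fun i hi => ?_
  have hp := mem_chart_target E p
  have h1 : formInChart α.d.1 p =ᶠ[𝓝 (chartAt E p p)] fun y =>
      ContinuousAlternatingMap.alternatizeUncurryFinCLM ℝ E ℝ (fderiv ℝ (formInChart α.1 p) y) := by
    filter_upwards [(chartAt E p).open_target.mem_nhds hp] with z hz
    exact formInChart_extDerivForm α p hz
  have h2 : ContDiffAt ℝ i (fderiv ℝ (formInChart α.1 p)) (chartAt E p p) :=
    (α.contDiffAt_formInChart p hp).fderiv_right (natCast_le_infty (i + 1))
  rw [(h1.iteratedFDeriv ℝ i).eq_of_nhds]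
  have h3 := (ContinuousAlternatingMap.alternatizeUncurryFinCLM (n := k) ℝ E ℝ).iteratedFDeriv_comp_left
    h2 le_rfl
  refine h3.trans ?_
  have h4 : iteratedFDeriv ℝ i (fderiv ℝ (formInChart α.1 p)) (chartAt E p p) = 0 := by
    rw [← norm_eq_zero, norm_iteratedFDeriv_fderiv, mem_vanishingForms.1 h (i + 1) (by omega),
      norm_zero]
  rw [h4]
  ext
  simp [ContinuousAlternatingMap.alternatizeUncurryFin_apply]

variable [FiniteDimensional ℝ E]

lemma finiteDimensional_continuousMultilinearMap (n : ℕ) (G : Type*) [NormedAddCommGroup G]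
    [NormedSpace ℝ G] [FiniteDimensional ℝ G] : FiniteDimensional ℝ (E [×n]→L[ℝ] G) :=
  FiniteDimensional.of_injective
    (ContinuousMultilinearMap.toMultilinearMapLinear :
      (E [×n]→L[ℝ] G) →ₗ[ℝ] MultilinearMap ℝ (fun _ : Fin n => E) G)
    ContinuousMultilinearMap.toMultilinearMap_injective

instance (k n : ℕ) : FiniteDimensional ℝ (JetSpace E k n) := by
  have := finiteDimensional_alternating (E := E) k
  have : ∀ i : Fin n, FiniteDimensional ℝ (E [×(i : ℕ)]→L[ℝ] (E [⋀^Fin k]→L[ℝ] ℝ)) :=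
    fun i => finiteDimensional_continuousMultilinearMap _ _
  exact Module.Finite.pi (M := fun i : Fin n => E [×(i : ℕ)]→L[ℝ] (E [⋀^Fin k]→L[ℝ] ℝ))

lemma finiteDimensional_quotient_vanishingForms (p : M) (k s : ℕ) :
    FiniteDimensional ℝ (DiffForm E M ∞ k ⧸ vanishingForms E p k s) := by
  exact Module.Finite.equiv (LinearMap.quotKerEquivRange
    (jetL (E := E) (M := M) k s (fun i _ => natCast_le_infty i) p).toLinearMap).symm

/-- In the Leibniz bound for the `n`-th derivative with `n < s + t`, each term has either `i < s` or
`n - i < t`. -/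
lemma wedge_mem_vanishingForms {p : M} {a b s t : ℕ} {α : DiffForm E M ∞ a} {β : DiffForm E M ∞ b}
    (hα : α ∈ vanishingForms E p a s) (hβ : β ∈ vanishingForms E p b t) :
    α.wedge β ∈ vanishingForms E p (a + b) (s + t) := by
  refine mem_vanishingForms.2 fun n hn => ?_
  have hp := mem_chart_target E p
  have ho := (chartAt E p).open_target
  rw [show formInChart (α.wedge β).1 p = fun y => altWedgeL E a b (formInChart α.1 p y)
    (formInChart β.1 p y) from funext fun y => by rw [altWedgeL_apply, formInChart_wedge]]
  have h := (altWedgeL E a b).norm_iteratedFDerivWithin_le_of_bilinear (α.2 p) (β.2 p)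
    ho.uniqueDiffOn hp (natCast_le_infty n)
  rw [iteratedFDerivWithin_of_isOpen n ho hp] at h
  rw [← norm_le_zero_iff]
  refine h.trans (le_of_eq ?_)
  rw [Finset.sum_eq_zero, mul_zero]
  intro i hin
  have := Finset.mem_range.1 hin
  rw [iteratedFDerivWithin_of_isOpen _ ho hp, iteratedFDerivWithin_of_isOpen _ ho hp]
  by_cases hi : i < s
  · rw [mem_vanishingForms.1 hα i hi]; simp
  · rw [mem_vanishingForms.1 hβ (n - i) (by omega)]; simp

/-- A linear functional on smooth forms that only depends on the jet of order `< n` extends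
continuously to all forms that have such a jet. -/
lemma exists_continuous_extension {p : M} {k n : ℕ} (l : DiffForm E M ∞ k →ₗ[ℝ] ℝ)
    (hl : ∀ α ∈ vanishingForms E p k n, l α = 0) {r : WithTop ℕ∞}
    (hn : ∀ i < n, (i : WithTop ℕ∞) ≤ r) :
    ∃ S : DiffForm E M r k →L[ℝ] ℝ, ∀ (α : DiffForm E M ∞ k) (β : DiffForm E M r k),
      β.1 = α.1 → S β = l α := by
  -- Since `l` vanishes on the kernel of the jet map, it is the pullback of a functional `g` on the
  -- jet space. Finite dimensionality makes `g` continuous, and the jet map is continuous already on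
  -- `C^r` forms.
  have h : l ∈ LinearMap.range
      (jetL (E := E) (M := M) k n (fun i _ => natCast_le_infty i) p).toLinearMap.dualMap := by
    rw [LinearMap.range_dualMap_eq_dualAnnihilator_ker, Submodule.mem_dualAnnihilator]
    exact hl
  obtain ⟨g, rfl⟩ := h
  refine ⟨(LinearMap.toContinuousLinearMap g).comp (jetL k n hn p), fun α β hαβ => ?_⟩
  change g (jetL k n hn p β) = g (jetL k n _ p α)
  congr 1
  funext i
  change iteratedFDeriv ℝ i (formInChart β.1 p) _ = iteratedFDeriv ℝ i (formInChart α.1 p) _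
  rw [hαβ]

/-- Linear functionals on jets at `p` are currents at `p`. -/
lemma exists_atomicCurrent {p : M} {k n : ℕ} (l : DiffForm E M ∞ k →ₗ[ℝ] ℝ)
    (hl : ∀ α ∈ vanishingForms E p k n, l α = 0) :
    ∃ T : atomicCurrents E p k, ∀ α, T.1 α = l α := by
  obtain ⟨S, hS⟩ := exists_continuous_extension l hl (r := ∞) fun i _ => natCast_le_infty i
  exact ⟨⟨S, fun α hα => by
    rw [hS α α rfl, hl α (mem_vanishingForms_of_eventually_eq_zero hα n)]⟩, fun α => hS α α rfl⟩

/-- Vanishing on `vanishingForms E p k (r + 1)` means dependence on derivatives of orders `0, …, r`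
only, and these are available for `C^r` forms. -/
lemma mem_orderFiltration_of_forall {p : M} {k r : ℕ} (T : atomicCurrents E p k)
    (hT : ∀ α ∈ vanishingForms E p k (r + 1), T.1 α = 0) : T ∈ orderFiltration E p k r := by
  obtain ⟨S, hS⟩ := exists_continuous_extension (r := r) T.1.toLinearMap hT
    fun i hi => by exact_mod_cast Nat.lt_succ_iff.1 hi
  exact ⟨S, fun α => hS α _ rfl⟩

end Jets

/-! ### Cutoffs of functions with vanishing jets -/

section Cutoff

variable {E : Type*} [NormedAddCommGroup E] [NormedSpace ℝ E] [FiniteDimensional ℝ E]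
  {G : Type*} [NormedAddCommGroup G] [NormedSpace ℝ G]

/-- The derivative of order `r + 1` is bounded on the compact ball. Going down one order at a time,
the mean value inequality on the ball of radius `‖y - y₀‖` gains one factor `‖y - y₀‖`, because the
lower derivative vanishes at `y₀`. -/
lemma exists_taylor_bound {β : E → G} {R : ℝ} {y₀ : E} (hR : 0 ≤ R)
    (hβ : ∀ y ∈ Metric.closedBall y₀ R, ContDiffAt ℝ ∞ β y) {r : ℕ}
    (h0 : ∀ i ≤ r, iteratedFDeriv ℝ i β y₀ = 0) (m b : ℕ) (hbm : b + m = r + 1) :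
    ∃ K : ℝ, 0 ≤ K ∧ ∀ y ∈ Metric.closedBall y₀ R, ‖iteratedFDeriv ℝ b β y‖ ≤ K * ‖y - y₀‖ ^ m := by
  induction m generalizing b with
  | zero =>
    have hc : ContinuousOn (iteratedFDeriv ℝ b β) (Metric.closedBall y₀ R) := fun y hy =>
      ((hβ y hy).continuousAt_iteratedFDeriv (natCast_le_infty b)).continuousWithinAt
    obtain ⟨K, hK⟩ := (isCompact_closedBall y₀ R).exists_bound_of_continuousOn hc
    exact ⟨K, (norm_nonneg _).trans (hK y₀ (Metric.mem_closedBall_self hR)),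
      fun y hy => by simpa using hK y hy⟩
  | succ m ih =>
    obtain ⟨K, hK0, hK⟩ := ih (b + 1) (by omega)
    refine ⟨K, hK0, fun y hy => ?_⟩
    have hsub : Metric.closedBall y₀ ‖y - y₀‖ ⊆ Metric.closedBall y₀ R :=
      Metric.closedBall_subset_closedBall (by rwa [← dist_eq_norm, ← Metric.mem_closedBall])
    have h := Convex.norm_image_sub_le_of_norm_fderiv_le (𝕜 := ℝ) (f := iteratedFDeriv ℝ b β)
      (s := Metric.closedBall y₀ ‖y - y₀‖) (C := K * ‖y - y₀‖ ^ m) (x := y₀) (y := y)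
      (fun z hz => (hβ z (hsub hz)).differentiableAt_iteratedFDeriv
        (by exact_mod_cast WithTop.coe_lt_coe.2 (ENat.natCast_lt_top b)))
      (fun z hz => by
        rw [norm_fderiv_iteratedFDeriv]
        refine (hK z (hsub hz)).trans ?_
        gcongr
        rwa [← dist_eq_norm, ← Metric.mem_closedBall])
      (convex_closedBall _ _) (Metric.mem_closedBall_self (norm_nonneg _))
      (by rw [Metric.mem_closedBall, dist_eq_norm])
    rw [h0 b (by omega), sub_zero] at h
    rwa [pow_succ, ← mul_assoc]

/-- A function whose jet of order `r` at `y₀` vanishes can be made `C^r`-small by a cutoff at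
`y₀`. -/
lemma exists_small_cutoff {β : E → G} {O : Set E} (hO : IsOpen O) {y₀ : E} (hy₀ : y₀ ∈ O)
    (hβ : ContDiffOn ℝ ∞ β O) {r : ℕ} (h0 : ∀ i ≤ r, iteratedFDeriv ℝ i β y₀ = 0) {R δ : ℝ}
    (hR : 0 < R) (hδ : 0 < δ) :
    ∃ χ : E → ℝ, ContDiff ℝ ∞ χ ∧ (∀ᶠ y in 𝓝 y₀, χ y = 1) ∧ (∀ y, R ≤ dist y y₀ → χ y = 0) ∧
      ∀ i ≤ r, ∀ y ∈ O, ‖iteratedFDeriv ℝ i (fun z => χ z • β z) y‖ ≤ δ := by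
  obtain ⟨R₀, hR₀, hball⟩ := Metric.nhds_basis_closedBall.mem_iff.1 (hO.mem_nhds hy₀)
  have hβat : ∀ y ∈ O, ContDiffAt ℝ ∞ β y := fun y hy => hβ.contDiffAt (hO.mem_nhds hy)
  -- a common constant in the Taylor estimates
  have hT := fun b : ℕ => fun hb : b ≤ r + 1 => exists_taylor_bound hR₀.le
    (fun y hy => hβat y (hball hy)) h0 (r + 1 - b) b (by omega)
  choose! K hK0 hK using hT
  -- a fixed bump function
  let χ₀ : ContDiffBump (0 : E) := ⟨1, 2, one_pos, one_lt_two⟩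
  have hχ : ∀ a : ℕ, ∃ C, ∀ y, ‖iteratedFDeriv ℝ a χ₀ y‖ ≤ C := fun a =>
    Continuous.bounded_above_of_compact_support
      ((χ₀.contDiff (n := ⊤)).continuous_iteratedFDeriv (natCast_le_infty a))
      (χ₀.hasCompactSupport.iteratedFDeriv a)
  choose C hC using hχ
  have hC0 : ∀ a, 0 ≤ C a := fun a => (norm_nonneg _).trans (hC a 0)
  -- `A` collects the constants of the Leibniz expansion. The factor `3` is there because the Taylor
  -- bounds are used on the ball of radius `3 * ε`.
  let A : ℝ := ∑ i ∈ Finset.range (r + 1), ∑ a ∈ Finset.range (i + 1),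
    (i.choose a : ℝ) * C a * (K (i - a) * 3 ^ (r + 1 - (i - a)))
  have hterm : ∀ i ∈ Finset.range (r + 1), ∀ a ∈ Finset.range (i + 1),
      0 ≤ (i.choose a : ℝ) * C a * (K (i - a) * 3 ^ (r + 1 - (i - a))) := fun i hi a _ => by
    have := hK0 (i - a) (by have := Finset.mem_range.1 hi; omega)
    have := hC0 a
    positivity
  have hA : 0 ≤ A := Finset.sum_nonneg fun i hi => Finset.sum_nonneg (hterm i hi)
  obtain ⟨ε, hε, hε1, hεR, hεR₀, hεδ⟩ : ∃ ε : ℝ, 0 < ε ∧ ε ≤ 1 ∧ 3 * ε ≤ R ∧ 3 * ε ≤ R₀ ∧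
      A * ε ≤ δ := by
    refine ⟨min (min 1 (δ / (A + 1))) (min (R / 3) (R₀ / 3)), by positivity, ?_, ?_, ?_, ?_⟩
    · exact (min_le_left _ _).trans (min_le_left _ _)
    · have := (min_le_right (min 1 (δ / (A + 1))) (min (R / 3) (R₀ / 3))).trans (min_le_left _ _)
      linarith
    · have := (min_le_right (min 1 (δ / (A + 1))) (min (R / 3) (R₀ / 3))).trans (min_le_right _ _)
      linarith
    · have h1 := (min_le_left (min 1 (δ / (A + 1))) (min (R / 3) (R₀ / 3))).trans (min_le_right _ _)
      have h2 : A * (δ / (A + 1)) ≤ δ := by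
        rw [mul_div_assoc', div_le_iff₀ (by linarith)]
        nlinarith
      exact (mul_le_mul_of_nonneg_left h1 hA).trans h2
  let χ : E → ℝ := fun y => χ₀ (ε⁻¹ • (y - y₀))
  have hχs : ContDiff ℝ ∞ χ := χ₀.contDiff.comp ((contDiff_id.sub contDiff_const).const_smul _)
  have hnorm : ∀ y, ‖ε⁻¹ • (y - y₀)‖ = ε⁻¹ * dist y y₀ := fun y => by
    rw [norm_smul, Real.norm_of_nonneg (by positivity), dist_eq_norm]
  have hχz : ∀ y, 2 * ε ≤ dist y y₀ → χ y = 0 := fun y hy => by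
    refine χ₀.zero_of_le_dist ?_
    rw [dist_zero_right, hnorm, inv_mul_eq_div, le_div_iff₀ hε]
    exact hy
  have hχd : ∀ a y, ‖iteratedFDeriv ℝ a χ y‖ ≤ (ε⁻¹) ^ a * C a := fun a y => by
    have h1 : iteratedFDeriv ℝ a χ y = (ε⁻¹) ^ a • iteratedFDeriv ℝ a χ₀ (ε⁻¹ • (y - y₀)) := by
      have h2 := iteratedFDeriv_comp_sub (𝕜 := ℝ) (f := fun z => χ₀ (ε⁻¹ • z)) a y₀ y
      rw [iteratedFDeriv_comp_const_smul ε⁻¹ (χ₀.contDiff (n := a))] at h2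
      exact h2
    rw [h1, norm_smul, Real.norm_of_nonneg (by positivity)]
    exact mul_le_mul_of_nonneg_left (hC a _) (by positivity)
  refine ⟨χ, hχs, ?_, fun y hy => hχz y (by linarith), fun i hi y hy => ?_⟩
  · filter_upwards [Metric.ball_mem_nhds y₀ hε] with y hy
    refine χ₀.one_of_mem_closedBall ?_
    rw [mem_closedBall_zero_iff, hnorm, inv_mul_eq_div, div_le_iff₀ hε]
    simpa [χ₀] using (Metric.mem_ball.1 hy).le
  -- The cutoff vanishes beyond `2 * ε`, so farther than `3 * ε` the product vanishes on a whole
  -- neighbourhood, with all its derivatives.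
  by_cases hfar : 3 * ε < dist y y₀
  · have : (fun z => χ z • β z) =ᶠ[𝓝 y] fun _ => 0 := by
      have hopen : {z | 2 * ε < dist z y₀} ∈ 𝓝 y :=
        (isOpen_lt continuous_const (continuous_id.dist continuous_const)).mem_nhds
          (show 2 * ε < dist y y₀ by linarith)
      filter_upwards [hopen] with z hz
      rw [hχz z (le_of_lt hz), zero_smul]
    rw [(this.iteratedFDeriv ℝ i).eq_of_nhds]
    simpa using hδ.le
  · push Not at hfar
    have hyb : y ∈ Metric.closedBall y₀ R₀ := Metric.mem_closedBall.2 (hfar.trans hεR₀)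
    have h := norm_iteratedFDerivWithin_smul_le hχs.contDiffOn hβ hO.uniqueDiffOn hy
      (natCast_le_infty i)
    rw [iteratedFDerivWithin_of_isOpen i hO hy] at h
    refine h.trans (le_trans ?_ hεδ)
    have hle : ∀ a ∈ Finset.range (i + 1), (i.choose a : ℝ) * ‖iteratedFDerivWithin ℝ a χ O y‖ *
        ‖iteratedFDerivWithin ℝ (i - a) β O y‖ ≤
        (i.choose a : ℝ) * C a * (K (i - a) * 3 ^ (r + 1 - (i - a))) * ε := fun a ha => by
      have ha := Finset.mem_range.1 ha
      rw [iteratedFDerivWithin_of_isOpen _ hO hy, iteratedFDerivWithin_of_isOpen _ hO hy]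
      have hKa := hK0 (i - a) (by omega)
      have h1 : ‖iteratedFDeriv ℝ (i - a) β y‖ ≤ K (i - a) * (3 * ε) ^ (r + 1 - (i - a)) := by
        refine (hK (i - a) (by omega) y hyb).trans ?_
        gcongr
        rwa [← dist_eq_norm]
      -- The power count: `a` derivatives of the cutoff cost `ε ^ (-a)`, while the derivative of
      -- order `i - a` of `β` is `O(ε ^ (r + 1 - i + a))`. Since `i ≤ r`, at least one factor `ε`
      -- survives.
      have h2 : (ε⁻¹) ^ a * (3 * ε) ^ (r + 1 - (i - a)) ≤ 3 ^ (r + 1 - (i - a)) * ε := by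
        have he : r + 1 - (i - a) = a + (r - i) + 1 := by omega
        have hr : ε ^ (r - i) ≤ 1 := pow_le_one₀ hε.le hε1
        rw [mul_pow, he, pow_succ ε, pow_add ε]
        have : (ε⁻¹) ^ a * ε ^ a = 1 := by rw [← mul_pow, inv_mul_cancel₀ hε.ne', one_pow]
        calc (ε⁻¹) ^ a * (3 ^ (a + (r - i) + 1) * (ε ^ a * ε ^ (r - i) * ε))
            = ((ε⁻¹) ^ a * ε ^ a) * (3 ^ (a + (r - i) + 1) * (ε ^ (r - i) * ε)) := by ring
          _ ≤ 3 ^ (a + (r - i) + 1) * ε := by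
            rw [this, one_mul]
            gcongr
            exact mul_le_of_le_one_left hε.le hr
      calc (i.choose a : ℝ) * ‖iteratedFDeriv ℝ a χ y‖ * ‖iteratedFDeriv ℝ (i - a) β y‖
          ≤ (i.choose a : ℝ) * ((ε⁻¹) ^ a * C a) * (K (i - a) * (3 * ε) ^ (r + 1 - (i - a))) := by
            have := hC0 a
            gcongr
            exact hχd a y
        _ = (i.choose a : ℝ) * C a * K (i - a) * ((ε⁻¹) ^ a * (3 * ε) ^ (r + 1 - (i - a))) := by ring
        _ ≤ (i.choose a : ℝ) * C a * K (i - a) * (3 ^ (r + 1 - (i - a)) * ε) := by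
            have := hC0 a
            gcongr
        _ = _ := by ring
    refine (Finset.sum_le_sum hle).trans ?_
    rw [← Finset.sum_mul]
    refine mul_le_mul_of_nonneg_right ?_ hε.le
    exact Finset.single_le_sum (f := fun i => ∑ a ∈ Finset.range (i + 1),
      (i.choose a : ℝ) * C a * (K (i - a) * 3 ^ (r + 1 - (i - a))))
      (fun i hi => Finset.sum_nonneg (hterm i hi)) (Finset.mem_range.2 (by omega))

end Cutoff

/-! ### Change of charts -/

section ChangeOfCharts

variable {E : Type*} [NormedAddCommGroup E] [NormedSpace ℝ E]
  {G : Type*} [NormedAddCommGroup G] [NormedSpace ℝ G]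

lemma ContDiffAt.exists_eventually_norm_iteratedFDeriv_le {f : E → G} {y : E}
    (hf : ContDiffAt ℝ ∞ f y) (n : ℕ) :
    ∃ C : ℝ, 1 ≤ C ∧ ∀ᶠ z in 𝓝 y, ∀ i ≤ n, ‖iteratedFDeriv ℝ i f z‖ ≤ C := by
  induction n with
  | zero =>
    have h := (hf.continuousAt_iteratedFDeriv (natCast_le_infty 0)).norm.eventually_le_const
      (lt_add_one _)
    refine ⟨max 1 (‖iteratedFDeriv ℝ 0 f y‖ + 1), le_max_left _ _, ?_⟩
    filter_upwards [h] with z hz i hi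
    rw [Nat.le_zero.1 hi]
    exact hz.trans (le_max_right _ _)
  | succ n ih =>
    obtain ⟨C, hC, hn⟩ := ih
    have h := (hf.continuousAt_iteratedFDeriv (natCast_le_infty (n + 1))).norm.eventually_le_const
      (lt_add_one _)
    refine ⟨max C (‖iteratedFDeriv ℝ (n + 1) f y‖ + 1), hC.trans (le_max_left _ _), ?_⟩
    filter_upwards [h, hn] with z hz hz' i hi
    rcases Nat.le_succ_iff.1 hi with hi | rfl
    · exact (hz' i hi).trans (le_max_left _ _)
    · exact hz.trans (le_max_right _ _)

/-- Locally uniform bound for the derivatives of `w ↦ L w (β (τ w))` in terms of those of `β`. -/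
lemma exists_eventually_norm_iteratedFDeriv_transform_le {O t : Set E} (hO : IsOpen O)
    (ht : IsOpen t) {τ : E → E} {L : E → G →L[ℝ] G} (hτ : ContDiffOn ℝ ∞ τ O)
    (hL : ContDiffOn ℝ ∞ L O) (hmap : Set.MapsTo τ O t) {y : E} (hy : y ∈ O) (n : ℕ) :
    ∃ C : ℝ, 0 ≤ C ∧ ∀ᶠ z in 𝓝 y, ∀ (β : E → G) (δ : ℝ), ContDiffOn ℝ n β t →
      (∀ i ≤ n, ‖iteratedFDeriv ℝ i β (τ z)‖ ≤ δ) →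
      ‖iteratedFDeriv ℝ n (fun w => L w (β (τ w))) z‖ ≤ C * δ := by
  obtain ⟨D, hD, hDτ⟩ := (hτ.contDiffAt (hO.mem_nhds hy)).exists_eventually_norm_iteratedFDeriv_le n
  obtain ⟨D', hD', hDL⟩ :=
    (hL.contDiffAt (hO.mem_nhds hy)).exists_eventually_norm_iteratedFDeriv_le n
  -- The constant combines the Leibniz rule for `L` applied to `β ∘ τ` with the Faà di Bruno bound
  -- for the composition. It depends on neither `β` nor `δ`.
  refine ⟨∑ i ∈ Finset.range (n + 1), (n.choose i : ℝ) * D' * ((n - i).factorial * D ^ (n - i)),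
    Finset.sum_nonneg fun i _ => by positivity, ?_⟩
  filter_upwards [hDτ, hDL, hO.mem_nhds hy] with z hzτ hzL hzO β δ hβ hδ
  have hτn : ContDiffOn ℝ n τ O := hτ.of_le (natCast_le_infty n)
  have h := norm_iteratedFDerivWithin_clm_apply (hL.of_le (natCast_le_infty n))
    (hβ.comp hτn hmap) hO.uniqueDiffOn hzO le_rfl
  rw [iteratedFDerivWithin_of_isOpen n hO hzO] at h
  refine h.trans ?_
  rw [Finset.sum_mul]
  refine Finset.sum_le_sum fun i hi => ?_
  have hi := Finset.mem_range.1 hi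
  have h1 : ‖iteratedFDerivWithin ℝ (n - i) (β ∘ τ) O z‖ ≤ (n - i).factorial * δ * D ^ (n - i) := by
    refine norm_iteratedFDerivWithin_comp_le hβ hτn (by exact_mod_cast Nat.sub_le n i)
      ht.uniqueDiffOn hO.uniqueDiffOn hmap hzO (fun j hj => ?_) fun j hj1 hj => ?_
    · rw [iteratedFDerivWithin_of_isOpen j ht (hmap hzO)]
      exact hδ j (by omega)
    · rw [iteratedFDerivWithin_of_isOpen j hO hzO]
      exact (hzτ j (by omega)).trans (le_self_pow₀ hD (by omega))
  rw [iteratedFDerivWithin_of_isOpen i hO hzO]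
  calc (n.choose i : ℝ) * ‖iteratedFDeriv ℝ i L z‖ * ‖iteratedFDerivWithin ℝ (n - i) (β ∘ τ) O z‖
      ≤ (n.choose i : ℝ) * D' * ((n - i).factorial * δ * D ^ (n - i)) := by
        gcongr
        exact hzL i (by omega)
    _ = _ := by ring

/-- Pullback is polynomial in the linear map. Its smoothness is taken from multilinear maps and
brought back to alternating ones by a linear left inverse of the inclusion, continuous by finite
dimensionality. -/
lemma contDiffOn_compContinuousLinearMapCLM [FiniteDimensional ℝ E] {k : ℕ} {O : Set E}
    {A : E → E →L[ℝ] E} (hA : ContDiffOn ℝ ∞ A O) :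
    ContDiffOn ℝ ∞ (fun z => (ContinuousAlternatingMap.compContinuousLinearMapCLM (A z) :
      (E [⋀^Fin k]→L[ℝ] ℝ) →L[ℝ] (E [⋀^Fin k]→L[ℝ] ℝ))) O := by
  have := finiteDimensional_alternating (E := E) k
  have := finiteDimensional_continuousMultilinearMap (E := E) k ℝ
  rw [contDiffOn_clm_apply]
  intro η
  let incl : (E [⋀^Fin k]→L[ℝ] ℝ) →L[ℝ] (E [×k]→L[ℝ] ℝ) :=
    ContinuousAlternatingMap.toContinuousMultilinearMapCLM ℝ
  obtain ⟨g, hg⟩ := incl.toLinearMap.exists_leftInverse_of_injective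
    (LinearMap.ker_eq_bot.2 ContinuousAlternatingMap.toContinuousMultilinearMap_injective)
  have h1 : ContDiffOn ℝ ∞ (fun z => ContinuousMultilinearMap.compContinuousLinearMapContinuousMultilinear
      ℝ (fun _ : Fin k => E) (fun _ : Fin k => E) ℝ (fun _ => A z) η.toContinuousMultilinearMap) O :=
    ((ContinuousMultilinearMap.contDiff _).comp_contDiffOn
      (contDiffOn_pi.2 fun _ => hA)).clm_apply contDiffOn_const
  refine ((LinearMap.toContinuousLinearMap g).contDiff.comp_contDiffOn h1).congr fun z _ => ?_
  exact (LinearMap.congr_fun hg (η.compContinuousLinearMap (A z))).symm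

end ChangeOfCharts

/-! ### Convergence of forms supported in a chart -/

section Localization

variable {E : Type*} [NormedAddCommGroup E] [NormedSpace ℝ E]
  {M : Type*} [TopologicalSpace M] [ChartedSpace E M]

/-- The set of points of the chart at `x₀` whose image lies in the domain of the chart at `x₁`. -/
def chartOverlap (E : Type*) [NormedAddCommGroup E] {M : Type*} [TopologicalSpace M]
    [ChartedSpace E M] (x₀ x₁ : M) : Set E :=
  (chartAt E x₀).target ∩ (chartAt E x₀).symm ⁻¹' (chartAt E x₁).source

lemma isOpen_chartOverlap {E : Type*} [NormedAddCommGroup E] [ChartedSpace E M] (x₀ x₁ : M) :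
    IsOpen (chartOverlap E x₀ x₁) :=
  (chartAt E x₀).isOpen_inter_preimage_symm (chartAt E x₁).open_source

lemma atomicCurrent_congr {p : M} {k : ℕ} (T : atomicCurrents E p k) {α β : DiffForm E M ∞ k}
    (h : ∀ᶠ x in 𝓝 p, α.1 x = β.1 x) : T.1 α = T.1 β := by
  rw [← sub_eq_zero, ← map_sub]
  refine T.2 _ ?_
  filter_upwards [h] with x hx
  change α.1 x - β.1 x = 0
  rw [hx, sub_self]

section

variable [IsManifold 𝓘(ℝ, E) ∞ M]

lemma contDiffOn_chartTransition (x₀ x₁ : M) :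
    ContDiffOn ℝ ∞ (fun z => chartAt E x₁ ((chartAt E x₀).symm z)) (chartOverlap E x₀ x₁) := by
  rw [← contMDiffOn_iff_contDiffOn]
  exact (contMDiffOn_chart (I := 𝓘(ℝ, E)) (n := ∞) (x := x₁)).comp
    ((contMDiffOn_chart_symm (I := 𝓘(ℝ, E)) (n := ∞) (x := x₀)).mono Set.inter_subset_left)
    Set.inter_subset_right

/-- The transformation rule for coordinate expressions of forms. -/
lemma formInChart_eq_pullback {k : ℕ} (α : RawForm E M k) (x₀ x₁ : M) {z : E}
    (hz : z ∈ chartOverlap E x₀ x₁) :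
    formInChart α x₀ z = ContinuousAlternatingMap.compContinuousLinearMapCLM
      (fderiv ℝ (fun w => chartAt E x₁ ((chartAt E x₀).symm w)) z)
      (formInChart α x₁ (chartAt E x₁ ((chartAt E x₀).symm z))) := by
  set φ := chartAt E x₀
  set ψ := chartAt E x₁
  let τ : E → E := fun w => ψ (φ.symm w)
  obtain ⟨hz₀, hz₁⟩ := hz
  have hz₁ : φ.symm z ∈ ψ.source := hz₁
  have hne : (∞ : WithTop ℕ∞) ≠ 0 := by simp
  have hφ : MDifferentiableAt 𝓘(ℝ, E) 𝓘(ℝ, E) φ.symm z :=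
    ((contMDiffOn_chart_symm (I := 𝓘(ℝ, E)) (n := ∞) (x := x₀)).contMDiffAt
      (φ.open_target.mem_nhds hz₀)).mdifferentiableAt hne
  have hψ : MDifferentiableAt 𝓘(ℝ, E) 𝓘(ℝ, E) ψ (φ.symm z) :=
    ((contMDiffOn_chart (I := 𝓘(ℝ, E)) (n := ∞) (x := x₁)).contMDiffAt
      (ψ.open_source.mem_nhds hz₁)).mdifferentiableAt hne
  have hψs : MDifferentiableAt 𝓘(ℝ, E) 𝓘(ℝ, E) ψ.symm (τ z) :=
    ((contMDiffOn_chart_symm (I := 𝓘(ℝ, E)) (n := ∞) (x := x₁)).contMDiffAt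
      (ψ.open_target.mem_nhds (ψ.map_source hz₁))).mdifferentiableAt hne
  have hτ : MDifferentiableAt 𝓘(ℝ, E) 𝓘(ℝ, E) τ z := hψ.comp z hφ
  have hcomp : (ψ.symm ∘ τ) =ᶠ[𝓝 z] φ.symm := by
    filter_upwards [(φ.continuousAt_symm hz₀).eventually (ψ.open_source.mem_nhds hz₁)] with w hw
    exact ψ.left_inv hw
  have hchain := mfderiv_comp z hψs hτ
  rw [hcomp.mfderiv_eq, mfderiv_eq_fderiv] at hchain
  have key : ∀ (G : M → E [⋀^Fin k]→L[ℝ] ℝ) (q q' : M) (_ : q = q') (A B : E →L[ℝ] E) (_ : A = B),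
      (G q).compContinuousLinearMap A = (G q').compContinuousLinearMap B := by
    rintro G q _ rfl A _ rfl; rfl
  exact key α _ _ (ψ.left_inv hz₁).symm _ _ hchain

variable [FiniteDimensional ℝ E] [T2Space M]

/-- A sequence of forms supported in a fixed compact subset of the chart at `p`, whose derivatives
in that chart converge uniformly to zero, converges to zero. -/
lemma tendsto_zero_of_formInChart {p : M} {r : WithTop ℕ∞} {k : ℕ} {Q : Set M} (hQ : IsCompact Q)
    (hQs : Q ⊆ (chartAt E p).source) {γ : ℕ → DiffForm E M r k} (hγ : ∀ n, ∀ x ∉ Q, (γ n).1 x = 0)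
    (hlim : ∀ i : ℕ, (i : WithTop ℕ∞) ≤ r → ∀ δ > 0, ∀ᶠ n in Filter.atTop,
      ∀ y ∈ (chartAt E p).target, ‖iteratedFDeriv ℝ i (formInChart (γ n).1 p) y‖ ≤ δ) :
    Filter.Tendsto γ Filter.atTop (𝓝 0) := by
  rw [nhds_iInf, Filter.tendsto_iInf]
  intro x₀
  rw [nhds_iInf, Filter.tendsto_iInf]
  intro j
  rw [nhds_iInf, Filter.tendsto_iInf]
  intro hj
  rw [nhds_induced, Filter.tendsto_comap_iff, UniformOnFun.tendsto_iff_tendstoUniformlyOn]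
  rintro K ⟨hK, hKt⟩
  rw [← tendstoLocallyUniformlyOn_iff_tendstoUniformlyOn_of_compact hK,
    Metric.tendstoLocallyUniformlyOn_iff]
  intro ε hε y hy
  have hzero : ∀ z : E, iteratedFDeriv ℝ j (formInChart (0 : DiffForm E M r k).1 x₀) z = 0 :=
    fun z => by
      change iteratedFDeriv ℝ j (fun _ => (0 : E [⋀^Fin k]→L[ℝ] ℝ)) z = 0
      simp
  suffices h : ∃ t ∈ 𝓝 y, ∀ᶠ n in Filter.atTop, ∀ z ∈ t,
      ‖iteratedFDeriv ℝ j (formInChart (γ n).1 x₀) z‖ < ε by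
    obtain ⟨t, ht, h⟩ := h
    refine ⟨t, mem_nhdsWithin_of_mem_nhds ht, ?_⟩
    filter_upwards [h] with n hn z hz
    have := hn z hz
    change dist (iteratedFDeriv ℝ j (formInChart (0 : DiffForm E M r k).1 x₀) z)
      (iteratedFDeriv ℝ j (formInChart (γ n).1 x₀) z) < ε
    rwa [hzero, dist_zero_left]
  -- Near a point of `Q` the estimates are transferred from the chart at `p` by the change of
  -- charts. Away from `Q`, which is closed because `M` is Hausdorff, all the forms vanish on a
  -- neighbourhood.
  by_cases hyQ : (chartAt E x₀).symm y ∈ Q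
  · have hyO : y ∈ chartOverlap E x₀ p := ⟨hKt hy, hQs hyQ⟩
    have hO := isOpen_chartOverlap (E := E) x₀ p
    have hmap : Set.MapsTo (fun z => chartAt E p ((chartAt E x₀).symm z)) (chartOverlap E x₀ p)
        (chartAt E p).target := fun z hz => (chartAt E p).map_source hz.2
    have hτ := contDiffOn_chartTransition (E := E) x₀ p
    obtain ⟨C, hC, hbound⟩ := exists_eventually_norm_iteratedFDeriv_transform_le hO
      (chartAt E p).open_target hτ (contDiffOn_compContinuousLinearMapCLM (k := k)
        (hτ.fderiv_of_isOpen hO (by simp))) hmap hyO j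
    refine ⟨_, Filter.inter_mem hbound (hO.mem_nhds hyO), ?_⟩
    have hall : ∀ᶠ n in Filter.atTop, ∀ i ∈ Finset.range (j + 1), ∀ z ∈ (chartAt E p).target,
        ‖iteratedFDeriv ℝ i (formInChart (γ n).1 p) z‖ ≤ ε / (C + 1) := by
      rw [Filter.eventually_all_finset]
      intro i hi
      exact hlim i (le_trans (by exact_mod_cast Nat.lt_succ_iff.1 (Finset.mem_range.1 hi)) hj) _
        (by positivity)
    filter_upwards [hall] with n hn z hz
    obtain ⟨hz, hzO⟩ := hz
    have h1 : formInChart (γ n).1 x₀ =ᶠ[𝓝 z] fun w =>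
        ContinuousAlternatingMap.compContinuousLinearMapCLM
          (fderiv ℝ (fun w => chartAt E p ((chartAt E x₀).symm w)) w)
          (formInChart (γ n).1 p (chartAt E p ((chartAt E x₀).symm w))) := by
      filter_upwards [hO.mem_nhds hzO] with w hw using formInChart_eq_pullback _ _ _ hw
    rw [(h1.iteratedFDeriv ℝ j).eq_of_nhds]
    refine (hz (formInChart (γ n).1 p) (ε / (C + 1)) (((γ n).2 p).of_le hj) fun i hi =>
      hn i (Finset.mem_range.2 (by omega)) _ (hmap hzO)).trans_lt ?_
    rw [mul_div_assoc', div_lt_iff₀ (by positivity)]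
    nlinarith
  · have hopen : {z | z ∈ (chartAt E x₀).target ∧ (chartAt E x₀).symm z ∈ Qᶜ} ∈ 𝓝 y :=
      ((chartAt E x₀).isOpen_inter_preimage_symm hQ.isClosed.isOpen_compl).mem_nhds ⟨hKt hy, hyQ⟩
    refine ⟨_, eventually_mem_nhds_iff.2 hopen, Filter.Eventually.of_forall fun n z hz => ?_⟩
    have h1 : formInChart (γ n).1 x₀ =ᶠ[𝓝 z] fun _ => 0 := by
      filter_upwards [hz] with w hw
      simp only [formInChart, hγ n _ hw.2]
      rfl
    rw [(h1.iteratedFDeriv ℝ j).eq_of_nhds]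
    simpa using hε

/-- The product of a smooth form with a smooth function. -/
def DiffForm.funSMul (ρ : M → ℝ) (hρ : ContMDiff 𝓘(ℝ, E) 𝓘(ℝ, ℝ) ∞ ρ) {k : ℕ}
    (α : DiffForm E M ∞ k) : DiffForm E M ∞ k :=
  ⟨fun x => ρ x • α.1 x, fun x₀ => by
    have h : ContDiffOn ℝ ∞ (fun y => ρ ((chartAt E x₀).symm y)) (chartAt E x₀).target := by
      rw [← contMDiffOn_iff_contDiffOn]
      exact hρ.comp_contMDiffOn (contMDiffOn_chart_symm (I := 𝓘(ℝ, E)) (n := ∞) (x := x₀))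
    exact h.smul (α.2 x₀)⟩

/-- A smooth form whose jet of order `r` at `p` vanishes agrees near `p` with `C^r`-small forms
with support in a fixed compact set. -/
lemma exists_small_form (p : M) : ∃ Q : Set M, IsCompact Q ∧ Q ⊆ (chartAt E p).source ∧
    ∀ (k r : ℕ), ∀ α ∈ vanishingForms E p k (r + 1), ∀ δ > 0, ∃ γ : DiffForm E M ∞ k,
      (∀ᶠ x in 𝓝 p, γ.1 x = α.1 x) ∧ (∀ x ∉ Q, γ.1 x = 0) ∧
      ∀ i ≤ r, ∀ y ∈ (chartAt E p).target, ‖iteratedFDeriv ℝ i (formInChart γ.1 p) y‖ ≤ δ := by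
  -- Two cutoffs are combined. The fixed bump `f` makes the product smooth on all of `M` and fixes
  -- the compact support. The cutoff `χ` provides smallness and vanishes outside the ball of radius
  -- `f.rIn`, inside which `f = 1`, so in the chart only `χ` is visible.
  obtain ⟨f⟩ : Nonempty (SmoothBumpFunction 𝓘(ℝ, E) p) := inferInstance
  refine ⟨tsupport f, f.hasCompactSupport, f.tsupport_subset_chartAt_source,
    fun k r α hα δ hδ => ?_⟩
  obtain ⟨χ, hχ, hχ1, hχR, hsmall⟩ := exists_small_cutoff (chartAt E p).open_target
    (mem_chart_target E p) (α.2 p) (r := r)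
    (fun i hi => mem_vanishingForms.1 hα i (Nat.lt_succ_iff.2 hi)) f.rIn_pos hδ
  have hρ : ContMDiff 𝓘(ℝ, E) 𝓘(ℝ, ℝ) ∞ fun x => f x • χ (chartAt E p x) :=
    f.contMDiff_smul (hχ.contMDiff.comp_contMDiffOn
      (contMDiffOn_chart (I := 𝓘(ℝ, E)) (n := ∞) (x := p)))
  refine ⟨α.funSMul _ hρ, ?_, fun x hx => ?_, fun i hi y hy => ?_⟩
  · have hc := ((chartAt E p).continuousAt (mem_chart_source E p)).eventually hχ1
    filter_upwards [f.eventuallyEq_one, hc] with x hx hx'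
    change (f x • χ (chartAt E p x)) • α.1 x = α.1 x
    rw [hx, hx']
    simp
  · change (f x • χ (chartAt E p x)) • α.1 x = 0
    rw [image_eq_zero_of_notMem_tsupport hx]
    simp
  · have h1 : formInChart (α.funSMul _ hρ).1 p =ᶠ[𝓝 y] fun z => χ z • formInChart α.1 p z := by
      filter_upwards [(chartAt E p).open_target.mem_nhds hy] with z hz
      change (f ((chartAt E p).symm z) • χ (chartAt E p ((chartAt E p).symm z))) •
        formInChart α.1 p z = χ z • formInChart α.1 p z
      rw [(chartAt E p).right_inv hz]
      by_cases hd : f.rIn ≤ dist z (chartAt E p p)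
      · rw [hχR z hd]; simp
      · rw [f.one_of_dist_le ((chartAt E p).map_target hz)]
        · simp
        · simpa [(chartAt E p).right_inv hz] using (not_le.1 hd).le
    rw [(h1.iteratedFDeriv ℝ i).eq_of_nhds]
    exact hsmall i hi y hy

/-- A current at `p` of order at most `r` only depends on jets of order `r` at `p`. -/
lemma eq_zero_of_mem_orderFiltration {p : M} {k r : ℕ} {T : atomicCurrents E p k}
    (hT : T ∈ orderFiltration E p k r) {α : DiffForm E M ∞ k}
    (hα : α ∈ vanishingForms E p k (r + 1)) : T.1 α = 0 := by
  obtain ⟨S, hS⟩ := hT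
  obtain ⟨Q, hQ, hQs, hsmall⟩ := exists_small_form (E := E) p
  -- All `γ n` agree with `α` near `p`, so `S` takes the constant value `T α` on a sequence tending
  -- to zero in `C^r`.
  choose γ hγα hγQ hγ using fun n : ℕ => hsmall k r α hα (1 / ((n : ℝ) + 1)) (by positivity)
  have hlim : Filter.Tendsto (fun n => (γ n).ofSmooth r) Filter.atTop (𝓝 0) := by
    refine tendsto_zero_of_formInChart hQ hQs hγQ fun i hi δ hδ => ?_
    filter_upwards [tendsto_one_div_add_atTop_nhds_zero_nat.eventually_le_const hδ] with n hn y hy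
    exact (hγ n i (by exact_mod_cast hi) y hy).trans hn
  have h1 := (S.continuous.tendsto 0).comp hlim
  rw [map_zero] at h1
  have h2 : (S ∘ fun n => (γ n).ofSmooth r) = fun _ => T.1 α := funext fun n => by
    rw [Function.comp_apply, hS, atomicCurrent_congr T (hγα n)]
  rw [h2] at h1
  exact tendsto_nhds_unique tendsto_const_nhds h1

/-- Currents at `p` have finite order. -/
lemma exists_mem_orderFiltration {p : M} {k : ℕ} (T : atomicCurrents E p k) :
    ∃ r, T ∈ orderFiltration E p k r := by
  by_contra! hT
  have hne : ∀ n : ℕ, ∃ α ∈ vanishingForms E p k (n + 1), T.1 α ≠ 0 := fun n => by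
    by_contra! h
    exact hT n (mem_orderFiltration_of_forall T h)
  choose α hα hTα using hne
  obtain ⟨Q, hQ, hQs, hsmall⟩ := exists_small_form (E := E) p
  -- Rescaling gives `T` the value `1` on each form. The `n`-th one is small up to order `n`, so
  -- each fixed order is eventually controlled and the sequence tends to zero in `C^∞`,
  -- contradicting continuity of `T`.
  choose γ hγα hγQ hγ using fun n : ℕ => hsmall k n ((T.1 (α n))⁻¹ • α n)
    (Submodule.smul_mem _ _ (hα n)) (1 / ((n : ℝ) + 1)) (by positivity)
  have hlim : Filter.Tendsto γ Filter.atTop (𝓝 0) := by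
    refine tendsto_zero_of_formInChart hQ hQs hγQ fun i _ δ hδ => ?_
    filter_upwards [tendsto_one_div_add_atTop_nhds_zero_nat.eventually_le_const hδ,
      Filter.eventually_ge_atTop i] with n hn hin y hy
    exact (hγ n i hin y hy).trans hn
  have h1 := (T.1.continuous.tendsto 0).comp hlim
  rw [map_zero] at h1
  have h2 : (T.1 ∘ γ) = fun _ => (1 : ℝ) := funext fun n => by
    rw [Function.comp_apply, atomicCurrent_congr T (hγα n), map_smul, smul_eq_mul,
      inv_mul_cancel₀ (hTα n)]
  rw [h2] at h1
  exact one_ne_zero (tendsto_nhds_unique tendsto_const_nhds h1)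

lemma mem_orderFiltration_iff {p : M} {k r : ℕ} {T : atomicCurrents E p k} :
    T ∈ orderFiltration E p k r ↔ ∀ α ∈ vanishingForms E p k (r + 1), T.1 α = 0 :=
  ⟨fun h _ hα => eq_zero_of_mem_orderFiltration h hα, mem_orderFiltration_of_forall T⟩

end

end Localization

/-! ### The coalgebra of currents supported at a point -/

section CurrentCoalgebra

/-- Evaluation of currents of dimension `k` at `p` on smooth `k`-forms. -/
def currentPairing (E : Type*) [NormedAddCommGroup E] [NormedSpace ℝ E] {M : Type*}
    [TopologicalSpace M] [ChartedSpace E M] (p : M) (k : ℕ) :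
    atomicCurrents E p k →ₗ[ℝ] DiffForm E M ∞ k →ₗ[ℝ] ℝ where
  toFun T := T.1.toLinearMap
  map_add' _ _ := rfl
  map_smul' _ _ := rfl

/-- The duality between smooth forms and currents at `p`. -/
def currentDuality (E : Type*) [NormedAddCommGroup E] [NormedSpace ℝ E] [FiniteDimensional ℝ E]
    {M : Type*} [TopologicalSpace M] [T2Space M] [ChartedSpace E M] [IsManifold 𝓘(ℝ, E) ∞ M]
    (p : M) : FilteredDuality (fun k => DiffForm E M ∞ k) (fun k => atomicCurrents E p k)
      (fun k r => orderFiltration E p k r) where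
  pair := currentPairing E p
  pair_injective _ S T h := Subtype.ext (ContinuousLinearMap.ext fun α => LinearMap.congr_fun h α)
  one := DiffForm.one
  mul := DiffForm.wedgeₗ E M
  d := DiffForm.dₗ E M
  J := vanishingForms E p
  J_zero := vanishingForms_zero p
  J_antitone := vanishingForms_antitone p
  J_finite := finiteDimensional_quotient_vanishingForms p
  mul_mem := wedge_mem_vanishingForms
  d_mem := d_mem_vanishingForms
  mem_iff _ _ _ := mem_orderFiltration_iff
  exhaustive _ := exists_mem_orderFiltration
  exists_pair _ _ l hl := (exists_atomicCurrent l hl).imp fun _ hT => LinearMap.ext hT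
  -- For `currentPairing`, `totalPairing` unfolds to `evalForm`, so casts in the identities between
  -- forms disappear under evaluation.
  mul_assoc α β γ := (DiffForm.evalForm_cast _ _).symm.trans
    (congrArg (evalForm p) (DiffForm.wedge_assoc α β γ))
  one_mul β := (DiffForm.evalForm_cast _ _).symm.trans
    (congrArg (evalForm p) (DiffForm.one_wedge β))
  mul_one β := congrArg (evalForm p) (DiffForm.wedge_one β)
  leibniz {a b} α β := by
    have h : ∀ γ δ : DiffForm E M ∞ (a + b + 1),
        evalForm p (γ + (-1 : ℝ) ^ a • δ) = evalForm p γ + (-1 : ℝ) ^ a • evalForm p δ :=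
      fun γ δ => LinearMap.ext fun T => by
        let S := DirectSum.component ℝ ℕ (fun k => atomicCurrents E p k) (a + b + 1) T
        change S.1 (γ + (-1 : ℝ) ^ a • δ) = S.1 γ + (-1 : ℝ) ^ a • S.1 δ
        rw [map_add, map_smul]
    refine (congrArg (evalForm p) (DiffForm.d_wedge α β)).trans ((h _ _).trans ?_)
    rw [DiffForm.evalForm_cast]
    rfl
  d_d := DiffForm.d_d
  d_one := DiffForm.d_one

end CurrentCoalgebra

end

theorem mainTheorem1 {E : Type*} [NormedAddCommGroup E] [NormedSpace ℝ E] [FiniteDimensional ℝ E]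
    {M : Type*} [TopologicalSpace M] [T2Space M] [ChartedSpace E M] [IsManifold 𝓘(ℝ, E) ∞ M]
    (p : M) :
    ∃ C : FilteredDGCoalgebra (fun k => atomicCurrents E p k) (fun k r => orderFiltration E p k r),
      (∀ (a b : ℕ) (α : DiffForm E M ∞ a) (β : DiffForm E M ∞ b) (T : ⨁ k, atomicCurrents E p k),
        evalTensor p α β (C.comul T) = evalForm p (α.wedge β) T) ∧
      (∀ T : ⨁ k, atomicCurrents E p k, C.counit T = evalForm p DiffForm.one T) ∧
      (∀ (k : ℕ) (T : atomicCurrents E p (k + 1)) (α : DiffForm E M ∞ k),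
        (C.boundary k T).1 α = T.1 α.d) :=
  ⟨(currentDuality E p).filteredDGCoalgebra,
    fun _ _ α β T => (currentDuality E p).tensorPairing_comul α β T, fun _ => rfl,
    fun k T α => (currentDuality E p).pair_boundary k T α⟩
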